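/- For integers $0\le m\le q$, $0\le n\le p$, real $\alpha_j,\beta_j$ and $A_j,B_j>0$ such that no pole of $\Gamma(\beta_i+B_is)$ $(1\le i\le m)$ is a pole of $\Gamma(1-\alpha_j-A_js)$ $(1\le j\le n)$, that is, $A_j(\beta_i+l)\ne B_i(\alpha_j-l'-1)$ for all $l,l'\in\mathbb N_0$, the Fox $H$-function is, for $z>0$, $$H^{m,n}_{p,q}\left[z\,\Big|\,{(\alpha_j,A_j)_1^p\atop(\beta_j,B_j)_1^q}\right]=\frac1{2\pi i}\int_{\mathcal C}\frac{\prod_{j=1}^m\Gamma(\beta_j+B_js)\prod_{j=1}^n\Gamma(1-\alpha_j-A_js)}{\prod_{j=m+1}^q\Gamma(1-\beta_j-B_js)\prod_{j=n+1}^p\Gamma(\alpha_j+A_js)}\,z^{-s}\,ds,$$ where the contour $\mathcal C$ runs from $c-i\infty$ to $c+i\infty$ for some real $c$ and leaves all poles of the $\Gamma(\beta_j+B_js)$, $j\le m$, on its left and all poles of the $\Gamma(1-\alpha_j-A_js)$, $j\le n$, on its right. Put $\chi=\sum_{j\le n}A_j-\sum_{j>n}A_j+\sum_{j\le m}B_j-\sum_{j>m}B_j$.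 Let $H^{m',n'}_{p',q'}\left[t\,\Big|\,{(\alpha'_j,A'_j)_1^{p'}\atop(\beta'_j,B'_j)_1^{q'}}\right]$ be such a Fox $H$-function that is positive for every $t>0$, with $m'n'>0$ and parameter $\chi'>0$. Let $k\ge1$ be an integer and let $\omega_1,\dots,\omega_{2k},\lambda_1,\dots,\lambda_{2k}$ be real numbers such that, for every $j=1,\dots,k$, $\omega_{2j}>0$, $\lambda_{2j}>0$, $$\omega_{2j-1}+\omega_{2j}\min_{1\le l\le m'}\frac{\beta'_l}{B'_l}>0,\qquad \lambda_{2j-1}+\lambda_{2j}\min_{1\le l\le m'}\frac{\beta'_l}{B'_l}>0 .$$ Let $(\alpha''_j,A''_j)_1^{p'+2k}$ be the list that consists of the pairs $(1-\omega_{2(k-j)+1},\omega_{2(k-j+1)}),\ (1-\lambda_{2(k-j)+1},\lambda_{2(k-j+1)})$ for $j=1,\dots,k$, in this order, followed by $(\alpha'_j,A'_j)_1^{p'}$. Then the Fox $H$-function $$H^{m',n'+2k}_{p'+2k,q'+k}\left[t\,\Big|\,{(\alpha''_j,A''_j)_1^{p'+2k}\atop(\beta'_j,B'_j)_1^{q'},\,(1-\omega_{2j-1}-\lambda_{2j-1},\,\omega_{2j}+\lambda_{2j})_1^k}\right]$$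 also satisfies the above conditions on its indexes and parameters, and it is positive for every $t>0$. -/

import Mathlib

/-- The integrand `Ξ_{p,q}^{m,n}` of the Mellin-Barnes integral, for real parameters.
`up` is the list `(α_j, A_j)_1^p`, `lo` is the list `(β_j, B_j)_1^q`; thus `p = up.length` and
`q = lo.length`. (Mathlib's Gamma function takes the value `0` at its poles, so a Gamma function
in the denominator that has a pole at `s` contributes the factor `0`, as it should.) -/
noncomputable def foxXi (m n : ℕ) (up lo : List (ℝ × ℝ)) (s : ℂ) : ℂ :=
  (((lo.take m).map fun x => Complex.Gamma ((x.1 : ℂ) + (x.2 : ℂ) * s)).prod *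
      ((up.take n).map fun x => Complex.Gamma (1 - (x.1 : ℂ) - (x.2 : ℂ) * s)).prod) /
    (((lo.drop m).map fun x => Complex.Gamma (1 - (x.1 : ℂ) - (x.2 : ℂ) * s)).prod *
      ((up.drop n).map fun x => Complex.Gamma ((x.1 : ℂ) + (x.2 : ℂ) * s)).prod)

/-- The constraints on indexes and (real) parameters under which the Fox `H`-function
`H_{p,q}^{m,n}` is considered: `0 ≤ n ≤ p`, `0 ≤ m ≤ q`, `A_j > 0`, `B_j > 0`, and no pole of a
`Γ(β_j + B_j s)`, `j ≤ m`, is a pole of a `Γ(1 - α_j - A_j s)`, `j ≤ n`. -/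
structure FoxAdmissible (m n : ℕ) (up lo : List (ℝ × ℝ)) : Prop where
  n_le : n ≤ up.length
  m_le : m ≤ lo.length
  up_pos : ∀ x ∈ up, 0 < x.2
  lo_pos : ∀ y ∈ lo, 0 < y.2
  poles_ne : ∀ x ∈ up.take n, ∀ y ∈ lo.take m, ∀ l l' : ℕ,
    x.2 * ((l : ℝ) + y.1) ≠ y.2 * (x.1 - (l' : ℝ) - 1)

/-- The parameter `χ` of the Fox `H`-function. -/
noncomputable def foxChi (m n : ℕ) (up lo : List (ℝ × ℝ)) : ℝ :=
  ((up.take n).map Prod.snd).sum - ((up.drop n).map Prod.snd).sum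
    + ((lo.take m).map Prod.snd).sum - ((lo.drop m).map Prod.snd).sum

/-- `min_{l = 1, …, m} β_l / B_l` (the infimum of a finite set, nonempty if
`1 ≤ m ≤ lo.length`). -/
noncomputable def foxMinRatio (m : ℕ) (lo : List (ℝ × ℝ)) : ℝ :=
  sInf ((fun y : ℝ × ℝ => y.1 / y.2) '' {y | y ∈ lo.take m})

/-- A piecewise continuously differentiable path that comes from `c - i∞` and goes to `c + i∞`,
for some real `c`, and is vertical near both ends. -/
def IsBarnesPath (γ : ℝ → ℂ) : Prop :=
  Continuous γ ∧
  (∃ breaks : Finset ℝ, ∀ t, t ∉ breaks → ContDiffAt ℝ 1 γ t) ∧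
  (∃ M : ℝ, ∀ t, ‖deriv γ t‖ ≤ M) ∧
  ∃ c R : ℝ, ∀ t : ℝ, R ≤ |t| → γ t = (c : ℂ) + (t : ℂ) * Complex.I

/-- The path avoids `w` and leaves it on its left-hand side: its (principal value) index with
respect to `w` is `1/2`, that is, `arg (γ t - w)` increases by `π` in total. -/
def LiesLeftOf (w : ℂ) (γ : ℝ → ℂ) : Prop :=
  (∀ t, γ t ≠ w) ∧
  Filter.Tendsto (fun T : ℝ => ∫ t in (-T)..T, deriv γ t / (γ t - w)) Filter.atTop
    (nhds ((Real.pi : ℂ) * Complex.I))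

/-- The path avoids `w` and leaves it on its right-hand side: its (principal value) index with
respect to `w` is `-1/2`. -/
def LiesRightOf (w : ℂ) (γ : ℝ → ℂ) : Prop :=
  (∀ t, γ t ≠ w) ∧
  Filter.Tendsto (fun T : ℝ => ∫ t in (-T)..T, deriv γ t / (γ t - w)) Filter.atTop
    (nhds (-((Real.pi : ℂ) * Complex.I)))

/-- `γ` is a contour for `H_{p,q}^{m,n}`: it leaves all poles `-(β_j + l) / B_j` of the
`Γ(β_j + B_j s)`, `j ≤ m`, on the left and all poles `(1 - α_j + l) / A_j` of the
`Γ(1 - α_j - A_j s)`, `j ≤ n`, on the right. -/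
def IsFoxContour (m n : ℕ) (up lo : List (ℝ × ℝ)) (γ : ℝ → ℂ) : Prop :=
  IsBarnesPath γ ∧
  (∀ y ∈ lo.take m, ∀ l : ℕ, LiesLeftOf ((-(y.1 + (l : ℝ)) / y.2 : ℝ) : ℂ) γ) ∧
  (∀ x ∈ up.take n, ∀ l : ℕ, LiesRightOf (((1 - x.1 + (l : ℝ)) / x.2 : ℝ) : ℂ) γ)

/-- The Mellin-Barnes integral `(2πi)⁻¹ ∫_γ Ξ_{p,q}^{m,n}(s) z^{-s} ds` at `z > 0`. -/
noncomputable def barnesIntegral (m n : ℕ) (up lo : List (ℝ × ℝ)) (γ : ℝ → ℂ) (z : ℝ) : ℂ :=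
  (2 * (Real.pi : ℂ) * Complex.I)⁻¹ *
    ∫ t : ℝ, foxXi m n up lo (γ t) * (z : ℂ) ^ (-γ t) * deriv γ t

open Classical in
/-- The Fox `H`-function `H_{p,q}^{m,n}[z | up; lo]` at `z > 0`: the Mellin-Barnes integral along
a contour from `c - i∞` to `c + i∞` that separates the two families of poles. For `χ > 0` the
integral converges absolutely and its value does not depend on the contour. (The value is `0`,
hence not positive, if there is no such contour or the integral does not converge.) -/
noncomputable def foxH (m n : ℕ) (up lo : List (ℝ × ℝ)) (z : ℝ) : ℂ :=
  if h : ∃ γ : ℝ → ℂ, IsFoxContour m n up lo γ then barnesIntegral m n up lo h.choose z else 0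

/-- The function is real and positive at every point of `ℝ⁺`. -/
def PositiveOnPosReals (f : ℝ → ℂ) : Prop :=
  ∀ t : ℝ, 0 < t → 0 < (f t).re ∧ (f t).im = 0

/-- The `2k` added upper pairs: for `j = 1, …, k`, the pairs
`(1 - ω_{2(k-j)+1}, ω_{2(k-j+1)})`, `(1 - λ_{2(k-j)+1}, λ_{2(k-j+1)})`. -/
def eulerUpper (k : ℕ) (om lam : ℕ → ℝ) : List (ℝ × ℝ) :=
  (List.range' 1 k).flatMap fun j =>
    [(1 - om (2 * (k - j) + 1), om (2 * (k - j + 1))),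
      (1 - lam (2 * (k - j) + 1), lam (2 * (k - j + 1)))]

/-- The `k` added lower pairs: for `j = 1, …, k`, the pair
`(1 - ω_{2j-1} - λ_{2j-1}, ω_{2j} + λ_{2j})`. -/
def eulerLower (k : ℕ) (om lam : ℕ → ℝ) : List (ℝ × ℝ) :=
  (List.range' 1 k).map fun j =>
    (1 - om (2 * j - 1) - lam (2 * j - 1), om (2 * j) + lam (2 * j))

/-! It suffices to add two upper pairs and one lower pair at a time. Let μ be the minimum of β_l/B_l
over l ≤ m. When Re s < min(a₁/a₂, b₁/b₂), the three new Gamma factors combine to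
Γ(a₁-a₂s)Γ(b₁-b₂s)/Γ(a₁+b₁-(a₂+b₂)s) = ∫₀¹ x^(a₁-a₂s-1) (1-x)^(b₁-b₂s-1) dx. Inserting this in the
Mellin-Barnes integral and exchanging the integrals gives H_new(z) = ∫₀¹ x^(a₁-1) (1-x)^(b₁-1) H(z
x^a₂ (1-x)^b₂) dx, whose integrand is positive (`PositiveOnPosReals.euler_step`). The step preserves
χ and μ, so it can be iterated.

The beta integral needs a contour to the left of min(a₁/a₂, b₁/b₂). All left poles have real part at
most -μ, which is below this bound, so any contour can be squashed into the required half-plane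
(`exists_isFoxContour_re_le`). Since `foxH` uses an arbitrarily chosen contour, the integral must be
independent of that choice (`barnesIntegral_eq_of_isFoxContour`). This follows from a form of
Cauchy's theorem, `tendsto_cutIntegral`, that sees the paths only through their indexes at the
poles.

Convergence, contour independence and Fubini all rest on the decay rate πχ/2 of the integrand in
vertical strips, up to powers of |Im s| (`stripBound_foxXi`), which comes from two-sided bounds for
Γ. -/

open Filter Topology
-- Growth of Γ and 1/Γ in vertical strips
/-- For fixed `y`, the quotient `‖Γ(x + iy)‖ / Γ(x)` is monotone in `x > 0`. -/
theorem norm_Gamma_div_Gamma_re_le {s w : ℂ} (hs : 0 < s.re) (hsw : s.re ≤ w.re)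
    (him : s.im = w.im) :
    ‖Complex.Gamma s‖ / Real.Gamma s.re ≤ ‖Complex.Gamma w‖ / Real.Gamma w.re := by
  have hw : 0 < w.re := hs.trans_le hsw
  -- In the quotient of Gauss's limits the factors n^x n! cancel; each remaining factor (x + j)/|x +
  -- j + iy| increases with x.
  have key : ∀ z : ℂ, 0 < z.re → Tendsto (fun n : ℕ => ∏ j ∈ Finset.range (n + 1),
      ((z.re + j) / ‖z + j‖)) atTop (𝓝 (‖Complex.Gamma z‖ / Real.Gamma z.re)) := by
    intro z hz
    have h1 := ((Complex.GammaSeq_tendsto_Gamma z).norm).div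
      (Real.GammaSeq_tendsto_Gamma z.re) (Real.Gamma_pos_of_pos hz).ne'
    refine h1.congr' ?_
    filter_upwards [eventually_gt_atTop 0] with n hn
    have hn' : (0 : ℝ) < n := by exact_mod_cast hn
    have hne : ((n : ℝ) ^ z.re * (n.factorial : ℝ)) ≠ 0 := by positivity
    have hp : (∏ j ∈ Finset.range (n + 1), (z.re + (j : ℝ))) ≠ 0 :=
      (Finset.prod_pos fun j _ => by positivity).ne'
    have hq : (∏ j ∈ Finset.range (n + 1), ‖z + (j : ℂ)‖) ≠ 0 := by
      refine (Finset.prod_pos fun j _ => ?_).ne'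
      refine norm_pos_iff.2 fun h => ?_
      have := congrArg Complex.re h
      simp at this
      have : (0 : ℝ) ≤ j := by positivity
      linarith
    simp only [Complex.GammaSeq, Real.GammaSeq, norm_div, norm_mul, norm_prod,
      Complex.norm_natCast, Finset.prod_div_distrib, Pi.div_apply]
    have : ‖(n : ℂ) ^ z‖ = (n : ℝ) ^ z.re := by
      have := Complex.norm_cpow_eq_rpow_re_of_pos hn' z
      simpa using this
    rw [this]
    field_simp
  refine le_of_tendsto_of_tendsto' (key s hs) (key w hw) fun n => ?_
  refine Finset.prod_le_prod (fun j _ => by positivity) fun j _ => ?_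
  have hj : (0 : ℝ) ≤ j := by positivity
  have e : ∀ z : ℂ, ‖z + (j : ℂ)‖ ^ 2 = (z.re + j) ^ 2 + z.im ^ 2 := by
    intro z
    rw [Complex.sq_norm, Complex.normSq_apply]
    simp
    ring
  have pos : ∀ z : ℂ, 0 < z.re → 0 < ‖z + (j : ℂ)‖ := by
    intro z hz
    refine norm_pos_iff.2 fun h => ?_
    have := congrArg Complex.re h
    simp at this
    linarith
  rw [div_le_div_iff₀ (pos s hs) (pos w hw)]
  refine le_of_sq_le_sq ?_ (by positivity)
  rw [mul_pow, mul_pow, e, e, him]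
  have : (s.re + j) ^ 2 ≤ (w.re + j) ^ 2 := by gcongr
  nlinarith [mul_le_mul_of_nonneg_right this (sq_nonneg w.im)]

/-- The square is Γ(1 + iy)Γ(1 - iy) = iy Γ(iy)Γ(1 - iy), to which the reflection formula applies.
-/
theorem norm_sq_Gamma_one_add_I {y : ℝ} (hy : y ≠ 0) :
    ‖Complex.Gamma (1 + y * Complex.I)‖ ^ 2 = Real.pi * y / Real.sinh (Real.pi * y) := by
  have h0 : (y : ℂ) * Complex.I ≠ 0 := by simp [hy]
  have h1 := Complex.Gamma_mul_Gamma_one_sub ((y : ℂ) * Complex.I)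
  have h2 := Complex.Gamma_add_one _ h0
  have h3 : (1 : ℂ) - y * Complex.I = (starRingEnd ℂ) (1 + y * Complex.I) := by
    simp [sub_eq_add_neg]
  have h4 : Complex.sin (Real.pi * ((y : ℂ) * Complex.I))
      = Complex.sinh (Real.pi * y) * Complex.I := by
    rw [← mul_assoc, Complex.sin_mul_I]
  have h5 : ((‖Complex.Gamma (1 + y * Complex.I)‖ ^ 2 : ℝ) : ℂ)
      = ((Real.pi * y / Real.sinh (Real.pi * y) : ℝ) : ℂ) := by
    push_cast
    rw [← Complex.mul_conj', ← Complex.Gamma_conj, ← h3, add_comm (1 : ℂ), h2, mul_assoc, h1, h4]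
    have : Complex.sinh (Real.pi * y) ≠ 0 := by
      rw [← Complex.ofReal_mul, ← Complex.ofReal_sinh]
      exact_mod_cast (Real.sinh_ne_zero.2 (by positivity))
    field_simp
  exact_mod_cast h5

theorem norm_Gamma_one_add_I_bounds {y : ℝ} (hy : 1 ≤ |y|) :
    Real.exp (-(Real.pi / 2) * |y|) ≤ ‖Complex.Gamma (1 + y * Complex.I)‖ ∧
      ‖Complex.Gamma (1 + y * Complex.I)‖ ≤ 4 * |y| * Real.exp (-(Real.pi / 2) * |y|) := by
  have hy0 : y ≠ 0 := by rintro rfl; simp at hy; linarith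
  have h := norm_sq_Gamma_one_add_I hy0
  have h' : Real.pi * y / Real.sinh (Real.pi * y)
      = Real.pi * |y| / Real.sinh (Real.pi * |y|) := by
    rcases abs_choice y with h | h <;> rw [h]
    rw [mul_neg, Real.sinh_neg, neg_div_neg_eq]
  rw [h'] at h
  have hpi := Real.pi_gt_three
  have hpi4 := Real.pi_le_four
  set r := |y| with hr
  have hsq : Real.exp (-(Real.pi / 2) * r) ^ 2 = Real.exp (-(Real.pi * r)) := by
    rw [← Real.exp_nat_mul]; congr 1; push_cast; ring
  have hE : Real.exp (-(Real.pi * r)) * Real.exp (Real.pi * r) = 1 := by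
    rw [← Real.exp_add]; simp
  have hEp := Real.exp_pos (Real.pi * r)
  have hEn := Real.exp_pos (-(Real.pi * r))
  have hsinh := Real.sinh_eq (Real.pi * r)
  have hspos : 0 < Real.sinh (Real.pi * r) := Real.sinh_pos_iff.2 (by positivity)
  constructor
  · refine le_of_sq_le_sq ?_ (norm_nonneg _)
    rw [hsq, h, le_div_iff₀ hspos, hsinh]
    nlinarith
  · refine le_of_sq_le_sq ?_ (by positivity)
    rw [mul_pow, hsq, h, div_le_iff₀ hspos, hsinh]
    have h1 : Real.exp (-(Real.pi * r)) ≤ 1 / 3 := by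
      have h3 : Real.pi * r ≥ 3 := by nlinarith
      have h4 := Real.add_one_le_exp (Real.pi * r)
      nlinarith
    have h2 : Real.exp (-(Real.pi * r)) * Real.exp (-(Real.pi * r)) ≤ 1 / 3 := by nlinarith
    have h5 : (4 * r) ^ 2 * Real.exp (-(Real.pi * r)) *
        ((Real.exp (Real.pi * r) - Real.exp (-(Real.pi * r))) / 2)
        = 8 * r ^ 2 * (1 - Real.exp (-(Real.pi * r)) * Real.exp (-(Real.pi * r))) := by
      rw [← hE]; ring
    rw [h5]
    nlinarith

/-- `‖f s‖ ≤ C |Im s| ^ N exp (-κ |Im s|)` in the strip `a ≤ Re s ≤ b`, away from the real axis. -/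
def StripBound (f : ℂ → ℂ) (a b κ : ℝ) : Prop :=
  ∃ C : ℝ, ∃ N : ℕ, ∃ T : ℝ, 0 ≤ C ∧ ∀ s : ℂ, a ≤ s.re → s.re ≤ b → T ≤ |s.im| →
    ‖f s‖ ≤ C * |s.im| ^ N * Real.exp (-κ * |s.im|)

namespace StripBound

theorem mul {f g : ℂ → ℂ} {a b κ μ : ℝ} (hf : StripBound f a b κ) (hg : StripBound g a b μ) :
    StripBound (fun s => f s * g s) a b (κ + μ) := by
  obtain ⟨C, N, T, hC, h⟩ := hf
  obtain ⟨C', N', T', hC', h'⟩ := hg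
  refine ⟨C * C', N + N', max T T', by positivity, fun s ha hb hT => ?_⟩
  rw [norm_mul]
  refine (mul_le_mul (h s ha hb ((le_max_left _ _).trans hT))
    (h' s ha hb ((le_max_right _ _).trans hT)) (norm_nonneg _) (by positivity)).trans_eq ?_
  rw [show -(κ + μ) * |s.im| = -κ * |s.im| + -μ * |s.im| by ring, Real.exp_add, pow_add]
  ring

theorem one (a b : ℝ) : StripBound (fun _ => 1) a b 0 :=
  ⟨1, 0, 0, zero_le_one, fun s _ _ _ => by simp⟩

theorem list_prod {ι : Type*} (l : List ι) (f : ι → ℂ → ℂ) (κ : ι → ℝ) (a b : ℝ)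
    (h : ∀ i ∈ l, StripBound (f i) a b (κ i)) :
    StripBound (fun s => (l.map fun i => f i s).prod) a b (l.map κ).sum := by
  induction l with
  | nil => simpa using one a b
  | cons i l ih =>
    simp only [List.map_cons, List.prod_cons, List.sum_cons]
    exact (h i (by simp)).mul (ih fun j hj => h j (by simp [hj]))

theorem congr {f g : ℂ → ℂ} {a b κ : ℝ} (hf : StripBound f a b κ)
    (hfg : ∀ s : ℂ, 1 ≤ |s.im| → g s = f s) : StripBound g a b κ := by
  obtain ⟨C, N, T, hC, h⟩ := hf
  refine ⟨C, N, max 1 T, hC, fun s h1 h2 h3 => ?_⟩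
  rw [hfg s ((le_max_left _ _).trans h3)]
  exact h s h1 h2 ((le_max_right _ _).trans h3)

theorem id (a b : ℝ) : StripBound (fun s => s) a b 0 := by
  refine ⟨max |a| |b| + 1, 1, 1, by positivity, fun s h1 h2 h3 => ?_⟩
  have := Complex.norm_le_abs_re_add_abs_im s
  have h4 : |s.re| ≤ max |a| |b| := abs_le_max_abs_abs h1 h2
  have : 0 ≤ max |a| |b| := by positivity
  simp
  nlinarith

theorem inv_id (a b : ℝ) : StripBound (fun s => s⁻¹) a b 0 := by
  refine ⟨1, 0, 1, by positivity, fun s h1 h2 h3 => ?_⟩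
  have := Complex.abs_im_le_norm s
  simp
  exact inv_le_one_of_one_le₀ (h3.trans this)

/-- The affine map moves the strip, hence the bound is assumed on all strips. Negative `B` is needed
for the factors Γ(1 - α - As). -/
theorem comp_affine {f : ℂ → ℂ} {κ : ℝ} (hf : ∀ a b, StripBound f a b κ) (β : ℝ) {B : ℝ}
    (hB : B ≠ 0) (a b : ℝ) : StripBound (fun s => f (β + B * s)) a b (κ * |B|) := by
  obtain ⟨C, N, T, hC, h⟩ := hf (min (β + B * a) (β + B * b)) (max (β + B * a) (β + B * b))
  refine ⟨C * |B| ^ N, N, T / |B|, by positivity, fun s h1 h2 h3 => ?_⟩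
  have hB' : 0 < |B| := abs_pos.2 hB
  have e : ((β : ℂ) + B * s).im = B * s.im := by simp
  have e' : ((β : ℂ) + B * s).re = β + B * s.re := by simp
  have := h (β + B * s) ?_ ?_ ?_
  · refine this.trans_eq ?_
    rw [e, abs_mul, mul_pow]
    ring_nf
  · rw [e']
    rcases le_total 0 B with hb | hb
    · exact (min_le_left _ _).trans (by gcongr)
    · exact (min_le_right _ _).trans (by nlinarith)
  · rw [e']
    rcases le_total 0 B with hb | hb
    · exact le_trans (by gcongr) (le_max_right _ _)
    · exact le_trans (by nlinarith) (le_max_left _ _)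
  · rw [e, abs_mul]
    rw [div_le_iff₀ hB'] at h3
    linarith

theorem shift {f : ℂ → ℂ} {a b κ : ℝ} (hf : StripBound f (a + 1) (b + 1) κ) :
    StripBound (fun s => f (s + 1)) a b κ := by
  obtain ⟨C, N, T, hC, h⟩ := hf
  refine ⟨C, N, T, hC, fun s h1 h2 h3 => ?_⟩
  simpa using h (s + 1) (by simpa using h1) (by simpa using h2) (by simpa using h3)

/-- The line Re s = 1 is explicit; each use of Γ(s) = (s - 1)Γ(s - 1) costs only one more power of
|Im s|. -/
theorem gamma_line (n : ℕ) :
    StripBound Complex.Gamma (n + 1) (n + 1) (Real.pi / 2) := by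
  induction n with
  | zero =>
    refine ⟨4, 1, 1, by positivity, fun s h1 h2 h3 => ?_⟩
    have hs : s = 1 + s.im * Complex.I := by
      apply Complex.ext <;> simp
      simp at h1 h2
      linarith
    have := (norm_Gamma_one_add_I_bounds h3).2
    rw [← hs] at this
    simpa using this
  | succ n ih =>
    obtain ⟨C, N, T, hC, h⟩ := ih
    obtain ⟨C', N', T', hC', h'⟩ := id (n + 1) (n + 1)
    refine ⟨C' * C, N' + N, max 1 (max T T'), by positivity, fun s h1 h2 h3 => ?_⟩
    have hne : s - 1 ≠ 0 := by
      intro h0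
      have := congrArg Complex.im h0
      simp at this
      rw [this] at h3
      simp at h3
      linarith
    have h4 := Complex.Gamma_add_one (s - 1) hne
    rw [sub_add_cancel] at h4
    push_cast at h1 h2
    have g1 : (n : ℝ) + 1 ≤ (s - 1).re := by simp; linarith
    have g2 : (s - 1).re ≤ (n : ℝ) + 1 := by simp; linarith
    have g3 : max T T' ≤ |(s - 1).im| := by simpa using (le_max_right _ _).trans h3
    have a1 := h _ g1 g2 ((le_max_left _ _).trans g3)
    have a2 := h' _ g1 g2 ((le_max_right _ _).trans g3)
    rw [h4, norm_mul]
    refine (mul_le_mul a2 a1 (norm_nonneg _) (by positivity)).trans_eq ?_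
    simp [pow_add]
    ring

/-- Monotonicity of |Γ(x + iy)|/Γ(x) compares the strip with an integer line to its right, and Γ is
bounded on the compact interval of real parts. -/
theorem gamma_of_one_le {a b : ℝ} (ha : 1 ≤ a) :
    StripBound Complex.Gamma a b (Real.pi / 2) := by
  obtain ⟨n, hn⟩ := exists_nat_ge b
  obtain ⟨C, N, T, hC, h⟩ := gamma_line n
  obtain ⟨D, hD⟩ := (isCompact_Icc (a := a) (b := b)).exists_bound_of_continuousOn
    (f := Real.Gamma) fun x hx =>
      (Real.differentiableAt_Gamma fun m => by
        have : (0 : ℝ) ≤ m := by positivity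
        linarith [hx.1]).continuousAt.continuousWithinAt
  have hG : 0 < Real.Gamma (n + 1) := Real.Gamma_pos_of_pos (by positivity)
  refine ⟨|D| * (C / Real.Gamma (n + 1)), N, T, by positivity, fun s h1 h2 h3 => ?_⟩
  have hs : 0 < s.re := by linarith
  have h4 := norm_Gamma_div_Gamma_re_le (s := s) (w := ((n + 1 : ℝ) : ℂ) + s.im * Complex.I) hs
    (by simp; linarith) (by simp)
  have h5 := h (((n + 1 : ℝ) : ℂ) + s.im * Complex.I) (by simp) (by simp) (by simpa using h3)
  have e : (((n + 1 : ℝ) : ℂ) + s.im * Complex.I).re = n + 1 := by simp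
  have e' : (((n + 1 : ℝ) : ℂ) + s.im * Complex.I).im = s.im := by simp
  rw [e] at h4
  rw [e'] at h5
  rw [div_le_iff₀ (Real.Gamma_pos_of_pos hs)] at h4
  have h6 : Real.Gamma s.re ≤ |D| :=
    (le_abs_self _).trans ((hD _ ⟨h1, h2⟩).trans (le_abs_self _))
  calc _ ≤ _ := h4
    _ ≤ (C * |s.im| ^ N * Real.exp (-(Real.pi / 2) * |s.im|)) / Real.Gamma (n + 1) * |D| := by
      gcongr
    _ = _ := by ring

/-- Here the comparison goes to the left, with the line Re s = 1, and yields a lower bound for |Γ|.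
-/
theorem inv_gamma_of_one_le {a b : ℝ} (ha : 1 ≤ a) :
    StripBound (fun s => (Complex.Gamma s)⁻¹) a b (-(Real.pi / 2)) := by
  obtain ⟨D, hD⟩ := (isCompact_Icc (a := a) (b := b)).exists_bound_of_continuousOn
    (f := fun x => (Real.Gamma x)⁻¹) fun x hx =>
      ((Real.differentiableAt_Gamma fun m => by
        have : (0 : ℝ) ≤ m := by positivity
        linarith [hx.1]).continuousAt.inv₀
          (Real.Gamma_pos_of_pos (by linarith [hx.1])).ne').continuousWithinAt
  refine ⟨|D|, 0, 1, by positivity, fun s h1 h2 h3 => ?_⟩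
  have hs : 0 < s.re := by linarith
  have h4 := norm_Gamma_div_Gamma_re_le (s := 1 + s.im * Complex.I) (w := s) (by simp)
    (by simp; linarith) (by simp)
  have h5 := (norm_Gamma_one_add_I_bounds h3).1
  have hG := Real.Gamma_pos_of_pos hs
  have h6 : (Real.Gamma s.re)⁻¹ ≤ |D| :=
    (le_abs_self _).trans ((hD _ ⟨h1, h2⟩).trans (le_abs_self _))
  simp only [Complex.add_re, Complex.one_re, Complex.mul_re, Complex.ofReal_re, Complex.I_re,
    mul_zero, Complex.ofReal_im, Complex.I_im, zero_mul, sub_self, add_zero, Real.Gamma_one,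
    div_one] at h4
  have h7 := h5.trans h4
  have h8 : 0 < ‖Complex.Gamma s‖ := by
    by_contra hcon
    have : ‖Complex.Gamma s‖ = 0 := le_antisymm (not_lt.1 hcon) (norm_nonneg _)
    rw [this, zero_div] at h7
    exact absurd (Real.exp_pos _) (not_lt.2 h7)
  rw [le_div_iff₀ hG] at h7
  rw [norm_inv, pow_zero, mul_one, inv_le_iff_one_le_mul₀ h8, neg_neg]
  have h9 : Real.exp (-(Real.pi / 2) * |s.im|) * Real.exp (Real.pi / 2 * |s.im|) = 1 := by
    rw [← Real.exp_add]; simp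
  have h10 : 1 ≤ |D| * Real.Gamma s.re := (inv_le_iff_one_le_mul₀ hG).1 h6
  have hE := Real.exp_pos (Real.pi / 2 * |s.im|)
  calc (1 : ℝ) ≤ |D| * Real.Gamma s.re := h10
    _ = |D| * Real.exp (Real.pi / 2 * |s.im|) *
        (Real.exp (-(Real.pi / 2) * |s.im|) * Real.Gamma s.re) := by
      linear_combination (-(|D| * Real.Gamma s.re)) * h9
    _ ≤ _ := by gcongr

/-- Induction on the distance of the strip from Re s ≥ 1: Γ(s) = Γ(s + 1)/s, and 1/s is bounded away
from the real axis. -/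
theorem gamma (a b : ℝ) : StripBound Complex.Gamma a b (Real.pi / 2) := by
  obtain ⟨n, hn⟩ := exists_nat_ge (1 - a)
  induction n generalizing a b with
  | zero => exact gamma_of_one_le (by simp at hn; linarith)
  | succ n ih =>
    have h := (inv_id a b).mul (ih (a + 1) (b + 1) (by push_cast at hn; linarith)).shift
    rw [zero_add] at h
    refine h.congr fun s hs => ?_
    have hne : s ≠ 0 := by rintro rfl; simp at hs; linarith
    rw [Complex.Gamma_add_one s hne, inv_mul_cancel_left₀ hne]

theorem inv_gamma (a b : ℝ) :
    StripBound (fun s => (Complex.Gamma s)⁻¹) a b (-(Real.pi / 2)) := by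
  obtain ⟨n, hn⟩ := exists_nat_ge (1 - a)
  induction n generalizing a b with
  | zero => exact inv_gamma_of_one_le (by simp at hn; linarith)
  | succ n ih =>
    have h := (id a b).mul (ih (a + 1) (b + 1) (by push_cast at hn; linarith)).shift
    rw [zero_add] at h
    exact h.congr fun s _ => Complex.one_div_Gamma_eq_self_mul_one_div_Gamma_add_one s

/-- A power of `|Im s|` is absorbed by a smaller exponential rate. -/
theorem exp_decay {f : ℂ → ℂ} {a b κ : ℝ} (hf : StripBound f a b κ) (hκ : 0 < κ) :
    ∃ C T : ℝ, 0 ≤ C ∧ ∀ s : ℂ, a ≤ s.re → s.re ≤ b → T ≤ |s.im| →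
      ‖f s‖ ≤ C * Real.exp (-(κ / 2) * |s.im|) := by
  obtain ⟨C, N, T, hC, h⟩ := hf
  have h0 := (tendsto_rpow_mul_exp_neg_mul_atTop_nhds_zero N (κ / 2) (by positivity))
  obtain ⟨T', hT'⟩ := eventually_atTop.1 (h0.eventually_le_const zero_lt_one)
  refine ⟨C, max T T', hC, fun s h1 h2 h3 => (h s h1 h2 ((le_max_left _ _).trans h3)).trans ?_⟩
  have h4 := hT' _ ((le_max_right _ _).trans h3)
  rw [Real.rpow_natCast] at h4
  rw [show -κ * |s.im| = -(κ / 2) * |s.im| + -(κ / 2) * |s.im| by ring, Real.exp_add,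
    mul_assoc, ← mul_assoc (|s.im| ^ N)]
  gcongr
  exact mul_le_of_le_one_left (Real.exp_pos _).le h4

end StripBound

/-! ### Decay of the Mellin-Barnes integrand -/

theorem prod_map_inv_eq {ι : Type*} (l : List ι) (f : ι → ℂ) :
    (l.map f).prod⁻¹ = (l.map fun i => (f i)⁻¹).prod := by
  induction l with
  | nil => simp
  | cons i l ih => simp [ih, mul_comm]

/-- In this form the denominator enters through the entire function 1/Γ and contributes no
singularities. -/
theorem foxXi_eq_mul_inv (m n : ℕ) (up lo : List (ℝ × ℝ)) (s : ℂ) :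
    foxXi m n up lo s =
      ((lo.take m).map fun x => Complex.Gamma ((x.1 : ℂ) + (x.2 : ℂ) * s)).prod *
      ((up.take n).map fun x => Complex.Gamma (1 - (x.1 : ℂ) - (x.2 : ℂ) * s)).prod *
      (((lo.drop m).map fun x => (Complex.Gamma (1 - (x.1 : ℂ) - (x.2 : ℂ) * s))⁻¹).prod *
      ((up.drop n).map fun x => (Complex.Gamma ((x.1 : ℂ) + (x.2 : ℂ) * s))⁻¹).prod) := by
  simp only [foxXi, div_eq_mul_inv, mul_inv, prod_map_inv_eq]

/-- A numerator factor with coefficient B adds πB/2 to the rate and a denominator factor subtracts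
it; the total is πχ/2. -/
theorem stripBound_foxXi {m n : ℕ} {up lo : List (ℝ × ℝ)} (hup : ∀ x ∈ up, 0 < x.2)
    (hlo : ∀ y ∈ lo, 0 < y.2) (a b : ℝ) :
    StripBound (foxXi m n up lo) a b (Real.pi / 2 * foxChi m n up lo) := by
  have g1 : ∀ y : ℝ × ℝ, 0 < y.2 → StripBound
      (fun s => Complex.Gamma ((y.1 : ℂ) + (y.2 : ℂ) * s)) a b (Real.pi / 2 * y.2) := fun y hy => by
    simpa [abs_of_pos hy] using StripBound.comp_affine StripBound.gamma y.1 hy.ne' a b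
  have g2 : ∀ y : ℝ × ℝ, 0 < y.2 → StripBound
      (fun s => (Complex.Gamma ((y.1 : ℂ) + (y.2 : ℂ) * s))⁻¹) a b (-(Real.pi / 2) * y.2) :=
    fun y hy => by
      simpa [abs_of_pos hy] using StripBound.comp_affine StripBound.inv_gamma y.1 hy.ne' a b
  have g3 : ∀ y : ℝ × ℝ, 0 < y.2 → StripBound
      (fun s => Complex.Gamma (1 - (y.1 : ℂ) - (y.2 : ℂ) * s)) a b (Real.pi / 2 * y.2) :=
    fun y hy => by
      simpa [abs_of_pos hy, sub_eq_add_neg] using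
        StripBound.comp_affine StripBound.gamma (1 - y.1) (neg_ne_zero.2 hy.ne') a b
  have g4 : ∀ y : ℝ × ℝ, 0 < y.2 → StripBound
      (fun s => (Complex.Gamma (1 - (y.1 : ℂ) - (y.2 : ℂ) * s))⁻¹) a b (-(Real.pi / 2) * y.2) :=
    fun y hy => by
      simpa [abs_of_pos hy, sub_eq_add_neg] using
        StripBound.comp_affine StripBound.inv_gamma (1 - y.1) (neg_ne_zero.2 hy.ne') a b
  have h1 := StripBound.list_prod (lo.take m) _ (fun y => Real.pi / 2 * y.2) a b
    fun y hy => g1 y (hlo y (List.mem_of_mem_take hy))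
  have h2 := StripBound.list_prod (up.take n) _ (fun y => Real.pi / 2 * y.2) a b
    fun y hy => g3 y (hup y (List.mem_of_mem_take hy))
  have h3 := StripBound.list_prod (lo.drop m) _ (fun y => -(Real.pi / 2) * y.2) a b
    fun y hy => g4 y (hlo y (List.mem_of_mem_drop hy))
  have h4 := StripBound.list_prod (up.drop n) _ (fun y => -(Real.pi / 2) * y.2) a b
    fun y hy => g2 y (hup y (List.mem_of_mem_drop hy))
  convert (h1.mul h2).mul (h3.mul h4) using 1
  · funext s
    exact foxXi_eq_mul_inv m n up lo s
  · have e : ∀ (l : List (ℝ × ℝ)) (c : ℝ), (l.map fun y => c * y.2).sum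
        = c * (l.map Prod.snd).sum := fun l c => by
      rw [← List.sum_map_mul_left]
    simp only [e, foxChi]
    ring

/-! ### Paths in a strip and Cauchy's theorem -/

/-- A path as in `IsBarnesPath`, with its data named, inside the strip `a < Re s < b`. -/
structure StripPath (γ : ℝ → ℂ) (a b c R : ℝ) : Prop where
  cont : Continuous γ
  smooth : ∃ breaks : Finset ℝ, ∀ t, t ∉ breaks → ContDiffAt ℝ 1 γ t
  bound : ∃ M : ℝ, ∀ t, ‖deriv γ t‖ ≤ M
  tail : ∀ t : ℝ, R ≤ |t| → γ t = (c : ℂ) + (t : ℂ) * Complex.I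
  mem : ∀ t, a < (γ t).re ∧ (γ t).re < b

theorem IsBarnesPath.exists_stripPath {γ : ℝ → ℂ} (h : IsBarnesPath γ) :
    ∃ K c R : ℝ, StripPath γ (-K) K c R := by
  obtain ⟨hc, hs, hb, c, R, ht⟩ := h
  obtain ⟨D, hD⟩ := (isCompact_Icc (a := -R) (b := R)).exists_bound_of_continuousOn
    (f := fun t => (γ t).re) (Complex.continuous_re.comp hc).continuousOn
  have key : ∀ t, |(γ t).re| < max D |c| + 1 := by
    intro t
    rcases le_total R |t| with h | h
    · rw [ht t h]
      simp
      linarith [le_max_right D |c|]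
    · have := hD t (abs_le.1 h)
      rw [Real.norm_eq_abs] at this
      linarith [le_max_left D |c|]
  exact ⟨max D |c| + 1, c, R, hc, hs, hb, ht, fun t => abs_lt.1 (key t)⟩

namespace StripPath

variable {γ γ₁ γ₂ : ℝ → ℂ} {a b c c₁ c₂ R R₁ R₂ : ℝ}

theorem mono (h : StripPath γ a b c R) {a' b' R' : ℝ} (ha : a' ≤ a) (hb : b ≤ b') (hR : R ≤ R') :
    StripPath γ a' b' c R' :=
  ⟨h.cont, h.smooth, h.bound, fun t ht => h.tail t (hR.trans ht),
    fun t => ⟨ha.trans_lt (h.mem t).1, (h.mem t).2.trans_le hb⟩⟩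

theorem tail_mem (h : StripPath γ a b c R) : a < c ∧ c < b := by
  have h1 := h.mem (max R 0)
  rw [h.tail (max R 0) ((le_max_left _ _).trans (le_abs_self _))] at h1
  simpa using h1

theorem intervalIntegrable (h : StripPath γ a b c R) {f : ℂ → ℂ}
    (hf : Continuous fun t => f (γ t)) (u v : ℝ) :
    IntervalIntegrable (fun t => f (γ t) * deriv γ t) MeasureTheory.volume u v := by
  obtain ⟨M, hM⟩ := h.bound
  have : IntervalIntegrable (deriv γ) MeasureTheory.volume u v := by
    refine (intervalIntegrable_const (c := M)).mono_fun
      (measurable_deriv γ).aestronglyMeasurable ?_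
    exact Eventually.of_forall fun t => (hM t).trans (le_abs_self M)
  exact this.continuousOn_mul hf.continuousOn

theorem integral_deriv (h : StripPath γ a b c R) {f F : ℂ → ℂ}
    (hF : ∀ t, HasDerivAt F (f (γ t)) (γ t)) (hf : Continuous fun t => f (γ t)) (u v : ℝ) :
    ∫ t in u..v, f (γ t) * deriv γ t = F (γ v) - F (γ u) := by
  obtain ⟨br, hbr⟩ := h.smooth
  refine MeasureTheory.integral_eq_of_hasDerivAt_off_countable (fun t => F (γ t)) _
    br.countable_toSet ?_ ?_ (h.intervalIntegrable hf u v)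
  · exact fun t _ =>
      ((hF t).continuousAt.comp (f := γ) h.cont.continuousAt).continuousWithinAt
  · intro t ht
    have h1 : HasDerivAt γ (deriv γ t) t :=
      ((hbr t ht.2).differentiableAt one_ne_zero).hasDerivAt
    exact (hF t).comp t h1

end StripPath

/-- The integral of `f` over the closed path formed by `γ₁` and the reverse of `γ₂`, cut off at
heights `±T` and joined by horizontal segments. -/
noncomputable def cutIntegral (f : ℂ → ℂ) (γ₁ γ₂ : ℝ → ℂ) (c₁ c₂ T : ℝ) : ℂ :=
  (∫ t in (-T)..T, f (γ₁ t) * deriv γ₁ t) - (∫ t in (-T)..T, f (γ₂ t) * deriv γ₂ t)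
    - (∫ x in c₂..c₁, f ((x : ℂ) + (T : ℂ) * Complex.I))
    + ∫ x in c₂..c₁, f ((x : ℂ) + ((-T : ℝ) : ℂ) * Complex.I)

section cut

variable {γ₁ γ₂ : ℝ → ℂ} {a b c₁ c₂ R : ℝ} {V : Set ℂ} {f g : ℂ → ℂ} {T : ℝ}

theorem re_mem_of_mem_uIcc (h₁ : StripPath γ₁ a b c₁ R) (h₂ : StripPath γ₂ a b c₂ R) {x : ℝ}
    (hx : x ∈ Set.uIcc c₂ c₁) : a < x ∧ x < b :=
  ⟨(lt_min h₂.tail_mem.1 h₁.tail_mem.1).trans_le hx.1,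
    hx.2.trans_lt (max_lt h₂.tail_mem.2 h₁.tail_mem.2)⟩

theorem horizontal_mem (h₁ : StripPath γ₁ a b c₁ R) (h₂ : StripPath γ₂ a b c₂ R)
    (hV : ∀ s : ℂ, a < s.re → s.re < b → s.im ≠ 0 → s ∈ V) (hT : T ≠ 0) {x : ℝ}
    (hx : x ∈ Set.uIcc c₂ c₁) : (x : ℂ) + (T : ℂ) * Complex.I ∈ V := by
  have := re_mem_of_mem_uIcc h₁ h₂ hx
  exact hV _ (by simpa using this.1) (by simpa using this.2) (by simpa using hT)

theorem cutIntegral_congr (h₁ : StripPath γ₁ a b c₁ R) (h₂ : StripPath γ₂ a b c₂ R)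
    (m₁ : ∀ t, γ₁ t ∈ V) (m₂ : ∀ t, γ₂ t ∈ V)
    (hV : ∀ s : ℂ, a < s.re → s.re < b → s.im ≠ 0 → s ∈ V) (hfg : Set.EqOn f g V) (hT : 0 < T) :
    cutIntegral f γ₁ γ₂ c₁ c₂ T = cutIntegral g γ₁ γ₂ c₁ c₂ T := by
  unfold cutIntegral
  congr 1
  · congr 1
    · simp only [hfg (m₁ _), hfg (m₂ _)]
    · exact intervalIntegral.integral_congr fun x hx =>
        hfg (horizontal_mem h₁ h₂ hV hT.ne' hx)
  · exact intervalIntegral.integral_congr fun x hx =>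
      hfg (horizontal_mem h₁ h₂ hV (neg_ne_zero.2 hT.ne') hx)

theorem continuous_comp_path {γ : ℝ → ℂ} (hγ : Continuous γ) (m : ∀ t, γ t ∈ V)
    (hf : ContinuousOn f V) : Continuous fun t => f (γ t) :=
  hf.comp_continuous hγ m

theorem horizontal_intervalIntegrable (h₁ : StripPath γ₁ a b c₁ R) (h₂ : StripPath γ₂ a b c₂ R)
    (hV : ∀ s : ℂ, a < s.re → s.re < b → s.im ≠ 0 → s ∈ V) (hf : ContinuousOn f V)
    (hT : T ≠ 0) : IntervalIntegrable (fun x : ℝ => f ((x : ℂ) + (T : ℂ) * Complex.I))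
      MeasureTheory.volume c₂ c₁ := by
  refine ContinuousOn.intervalIntegrable (hf.comp (by fun_prop) fun x hx => ?_)
  exact horizontal_mem h₁ h₂ hV hT hx

theorem cutIntegral_add_const_mul (h₁ : StripPath γ₁ a b c₁ R) (h₂ : StripPath γ₂ a b c₂ R)
    (m₁ : ∀ t, γ₁ t ∈ V) (m₂ : ∀ t, γ₂ t ∈ V)
    (hV : ∀ s : ℂ, a < s.re → s.re < b → s.im ≠ 0 → s ∈ V) (hf : ContinuousOn f V)
    (hg : ContinuousOn g V) (hT : 0 < T) (k : ℂ) :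
    cutIntegral (fun s => f s + k * g s) γ₁ γ₂ c₁ c₂ T
      = cutIntegral f γ₁ γ₂ c₁ c₂ T + k * cutIntegral g γ₁ γ₂ c₁ c₂ T := by
  have i₁ := fun f hf => h₁.intervalIntegrable (f := f)
    (continuous_comp_path h₁.cont m₁ hf) (-T) T
  have i₂ := fun f hf => h₂.intervalIntegrable (f := f)
    (continuous_comp_path h₂.cont m₂ hf) (-T) T
  have i₃ := fun f hf => horizontal_intervalIntegrable (f := f) h₁ h₂ hV hf hT.ne'
  have i₄ := fun f hf => horizontal_intervalIntegrable (f := f) h₁ h₂ hV hf (neg_ne_zero.2 hT.ne')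
  unfold cutIntegral
  simp only [add_mul, mul_assoc]
  rw [intervalIntegral.integral_add (i₁ f hf) ((i₁ g hg).const_mul k),
    intervalIntegral.integral_add (i₂ f hf) ((i₂ g hg).const_mul k),
    intervalIntegral.integral_add (i₃ f hf) ((i₃ g hg).const_mul k),
    intervalIntegral.integral_add (i₄ f hf) ((i₄ g hg).const_mul k)]
  simp only [intervalIntegral.integral_const_mul]
  ring

/-- With a primitive on V the four pieces telescope around the closed path, since both paths are
vertical from height R on. V may have holes. -/
theorem cutIntegral_eq_zero (h₁ : StripPath γ₁ a b c₁ R) (h₂ : StripPath γ₂ a b c₂ R)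
    (m₁ : ∀ t, γ₁ t ∈ V) (m₂ : ∀ t, γ₂ t ∈ V)
    (hV : ∀ s : ℂ, a < s.re → s.re < b → s.im ≠ 0 → s ∈ V) {F : ℂ → ℂ}
    (hf : ContinuousOn f V) (hF : ∀ s ∈ V, HasDerivAt F (f s) s) (hT : 0 < T) (hTR : R ≤ T) :
    cutIntegral f γ₁ γ₂ c₁ c₂ T = 0 := by
  have hor : ∀ T : ℝ, T ≠ 0 → ∫ x in c₂..c₁, f ((x : ℂ) + (T : ℂ) * Complex.I)
      = F ((c₁ : ℂ) + (T : ℂ) * Complex.I) - F ((c₂ : ℂ) + (T : ℂ) * Complex.I) := by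
    intro T hT
    refine intervalIntegral.integral_eq_sub_of_hasDerivAt
      (f := fun x : ℝ => F ((x : ℂ) + (T : ℂ) * Complex.I)) (fun x hx => ?_)
      (horizontal_intervalIntegrable h₁ h₂ hV hf hT)
    have h1 := hF _ (horizontal_mem h₁ h₂ hV hT hx)
    have h2 : HasDerivAt (fun y : ℝ => (y : ℂ) + (T : ℂ) * Complex.I) 1 x :=
      (Complex.ofRealCLM.hasDerivAt (x := x)).add_const _
    have h3 := h1.comp x h2
    rw [mul_one] at h3
    exact h3
  unfold cutIntegral
  rw [h₁.integral_deriv (fun t => hF _ (m₁ t)) (continuous_comp_path h₁.cont m₁ hf),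
    h₂.integral_deriv (fun t => hF _ (m₂ t)) (continuous_comp_path h₂.cont m₂ hf),
    hor T hT.ne', hor (-T) (neg_ne_zero.2 hT.ne'),
    h₁.tail T (hTR.trans (le_abs_self T)), h₂.tail T (hTR.trans (le_abs_self T)),
    h₁.tail (-T) (by rw [abs_neg]; exact hTR.trans (le_abs_self T)),
    h₂.tail (-T) (by rw [abs_neg]; exact hTR.trans (le_abs_self T))]
  ring

theorem tendsto_horizontal (h₁ : StripPath γ₁ a b c₁ R) (h₂ : StripPath γ₂ a b c₂ R)
    {e : ℝ → ℝ} (he : Tendsto e atTop (𝓝 0)) {T₀ : ℝ}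
    (hf : ∀ s : ℂ, a < s.re → s.re < b → T₀ ≤ |s.im| → ‖f s‖ ≤ e |s.im|) :
    Tendsto (fun T : ℝ => -(∫ x in c₂..c₁, f ((x : ℂ) + (T : ℂ) * Complex.I))
      + ∫ x in c₂..c₁, f ((x : ℂ) + ((-T : ℝ) : ℂ) * Complex.I)) atTop (𝓝 0) := by
  have hb : ∀ T : ℝ, max 0 T₀ ≤ |T| →
      ‖∫ x in c₂..c₁, f ((x : ℂ) + (T : ℂ) * Complex.I)‖ ≤ e |T| * |c₁ - c₂| := by
    intro T hT
    refine intervalIntegral.norm_integral_le_of_norm_le_const fun x hx => ?_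
    have := re_mem_of_mem_uIcc h₁ h₂ (Set.uIoc_subset_uIcc hx)
    simpa using hf ((x : ℂ) + (T : ℂ) * Complex.I) (by simpa using this.1) (by simpa using this.2)
      (by simpa using (le_max_right _ _).trans hT)
  have hlim : Tendsto (fun T => e T * |c₁ - c₂| + e T * |c₁ - c₂|) atTop (𝓝 0) := by
    simpa using (he.mul_const |c₁ - c₂|).add (he.mul_const |c₁ - c₂|)
  refine squeeze_zero_norm' ?_ hlim
  filter_upwards [eventually_ge_atTop (max 0 T₀)] with T hT
  have hT0 : |T| = T := abs_of_nonneg ((le_max_left _ _).trans hT)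
  have h3 := hb T (by rwa [hT0])
  have h4 := hb (-T) (by rwa [abs_neg, hT0])
  rw [abs_neg, hT0] at h4
  rw [hT0] at h3
  refine (norm_add_le _ _).trans ?_
  rw [norm_neg]
  gcongr

theorem tendsto_cutIntegral_inv (h₁ : StripPath γ₁ a b c₁ R) (h₂ : StripPath γ₂ a b c₂ R)
    {w L : ℂ} (hw : w.im = 0)
    (l₁ : Tendsto (fun T : ℝ => ∫ t in (-T)..T, deriv γ₁ t / (γ₁ t - w)) atTop (𝓝 L))
    (l₂ : Tendsto (fun T : ℝ => ∫ t in (-T)..T, deriv γ₂ t / (γ₂ t - w)) atTop (𝓝 L)) :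
    Tendsto (cutIntegral (fun s => (s - w)⁻¹) γ₁ γ₂ c₁ c₂) atTop (𝓝 0) := by
  have h := (l₁.sub l₂).add (tendsto_horizontal (f := fun s => (s - w)⁻¹) h₁ h₂
    tendsto_inv_atTop_zero (T₀ := 1) fun s _ _ hs => by
      rw [norm_inv]
      have := Complex.abs_im_le_norm (s - w)
      rw [Complex.sub_im, hw, sub_zero] at this
      gcongr)
  simp only [sub_self, add_zero] at h
  refine h.congr fun T => ?_
  simp only [cutIntegral, div_eq_mul_inv, mul_comm]
  ring

/-- Cauchy's theorem for two paths with equal indexes with respect to finitely many real poles. -/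
theorem tendsto_cutIntegral (h₁ : StripPath γ₁ a b c₁ R) (h₂ : StripPath γ₂ a b c₂ R)
    (S : Finset ℂ) (hS : ∀ w ∈ S, w.im = 0 ∧ (∀ t, γ₁ t ≠ w) ∧ (∀ t, γ₂ t ≠ w) ∧ ∃ L : ℂ,
      Tendsto (fun T : ℝ => ∫ t in (-T)..T, deriv γ₁ t / (γ₁ t - w)) atTop (𝓝 L) ∧
      Tendsto (fun T : ℝ => ∫ t in (-T)..T, deriv γ₂ t / (γ₂ t - w)) atTop (𝓝 L))
    (f : ℂ → ℂ) (hf : ∀ s : ℂ, a < s.re → s.re < b → s ∉ S → DifferentiableAt ℂ f s)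
    (hm : ∀ w ∈ S, MeromorphicAt f w) :
    Tendsto (cutIntegral f γ₁ γ₂ c₁ c₂) atTop (𝓝 0) := by
  induction S using Finset.induction_on generalizing f with
  | empty =>
    have hconv : Convex ℝ {s : ℂ | a < s.re ∧ s.re < b} :=
      (convex_halfSpace_re_gt a).inter (convex_halfSpace_re_lt b)
    have hopen : IsOpen {s : ℂ | a < s.re ∧ s.re < b} :=
      (isOpen_lt continuous_const Complex.continuous_re).inter
        (isOpen_lt Complex.continuous_re continuous_const)
    have hd : DifferentiableOn ℂ f {s : ℂ | a < s.re ∧ s.re < b} := fun s hs =>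
      (hf s hs.1 hs.2 (by simp)).differentiableWithinAt
    -- Without poles, f has a primitive on the whole convex strip.
    obtain ⟨F, hF⟩ := hconv.exists_forall_hasDerivWithinAt hd
    refine tendsto_const_nhds.congr' ?_
    filter_upwards [eventually_gt_atTop 0, eventually_ge_atTop R] with T hT hTR
    exact (cutIntegral_eq_zero (V := {s : ℂ | a < s.re ∧ s.re < b}) h₁ h₂ h₁.mem h₂.mem (fun s h h' _ => ⟨h, h'⟩) hd.continuousOn
      (fun s hs => (hF s hs).hasDerivAt (hopen.mem_nhds hs)) hT hTR).symm
  | insert w S hwS ih =>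
    obtain ⟨hw, n₁, n₂, L, l₁, l₂⟩ := hS w (Finset.mem_insert_self w S)
    have hS' := fun v hv => hS v (Finset.mem_insert_of_mem hv)
    set V : Set ℂ := {s : ℂ | a < s.re ∧ s.re < b ∧ s ∉ insert w S}
    have m₁ : ∀ t, γ₁ t ∈ V := fun t => ⟨(h₁.mem t).1, (h₁.mem t).2,
      fun h => (hS _ h).2.1 t rfl⟩
    have m₂ : ∀ t, γ₂ t ∈ V := fun t => ⟨(h₂.mem t).1, (h₂.mem t).2,
      fun h => (hS _ h).2.2.1 t rfl⟩
    have hV : ∀ s : ℂ, a < s.re → s.re < b → s.im ≠ 0 → s ∈ V := fun s h h' hi =>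
      ⟨h, h', fun hs => hi (hS s hs).1⟩
    have hVw : ∀ s ∈ V, s - w ≠ 0 := fun s hs h =>
      hs.2.2 (by rw [sub_eq_zero.1 h]; exact Finset.mem_insert_self w S)
    -- Near w, f = g/(z - w)^n with g analytic. Induction on n peels off the principal part at w one
    -- term at a time.
    suffices key : ∀ (n : ℕ) (f g : ℂ → ℂ), AnalyticAt ℂ g w →
        (∀ᶠ z in 𝓝[≠] w, f z = ((z - w) ^ n)⁻¹ * g z) → (∀ s ∈ V, DifferentiableAt ℂ f s) →
        (∀ v ∈ S, MeromorphicAt f v) →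
        Tendsto (cutIntegral f γ₁ γ₂ c₁ c₂) atTop (𝓝 0) by
      obtain ⟨n, hn⟩ := hm w (Finset.mem_insert_self w S)
      refine key n f _ hn ?_ (fun s hs => hf s hs.1 hs.2.1 hs.2.2)
        fun v hv => hm v (Finset.mem_insert_of_mem hv)
      filter_upwards [self_mem_nhdsWithin] with z hz
      have : (z - w) ^ n ≠ 0 := pow_ne_zero _ (sub_ne_zero.2 hz)
      simp [this]
    intro n
    induction n with
    | zero =>
      intro f g hg hfg hd hmer
      -- For n = 0 the singularity is removable: f is redefined at w, which the paths avoid, and the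
      -- pole set shrinks to S.
      have hne : ∀ z, z ≠ w → Function.update f w (g w) =ᶠ[𝓝 z] f := fun z hz => by
        filter_upwards [isOpen_ne.mem_nhds hz] with y hy
        exact Function.update_of_ne hy _ _
      have h := ih hS' (Function.update f w (g w)) ?_ fun v hv => (hmer v hv).update _ _
      · refine h.congr' ?_
        filter_upwards [eventually_gt_atTop 0] with T hT
        refine cutIntegral_congr h₁ h₂ m₁ m₂ hV (fun s hs => ?_) hT
        exact Function.update_of_ne (sub_ne_zero.1 (hVw s hs)) _ _
      · intro s hs1 hs2 hs3
        by_cases hsw : s = w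
        · subst hsw
          refine hg.differentiableAt.congr_of_eventuallyEq ?_
          rw [eventually_nhdsWithin_iff] at hfg
          filter_upwards [hfg] with z hz
          by_cases hzs : z = s
          · subst hzs; simp
          · simp [Function.update_of_ne hzs, hz hzs]
        · refine (hd s ⟨hs1, hs2, ?_⟩).congr_of_eventuallyEq (hne s hsw)
          simp [hsw, hs3]
    | succ n ihn =>
      intro f g hg hfg hd hmer
      set q : ℂ → ℂ := fun s => ((s - w) ^ (n + 1))⁻¹ with hq
      have hqm : ∀ v, MeromorphicAt q v := fun v => by
        have : AnalyticAt ℂ (fun s : ℂ => (s - w) ^ (n + 1)) v := by fun_prop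
        exact this.meromorphicAt.inv
      have hqd : ∀ s ∈ V, DifferentiableAt ℂ q s := fun s hs =>
        DifferentiableAt.inv (by fun_prop) (pow_ne_zero _ (hVw s hs))
      -- Only the simple pole needs the equality of the indexes; higher negative powers have a
      -- primitive off w.
      have hqlim : Tendsto (cutIntegral q γ₁ γ₂ c₁ c₂) atTop (𝓝 0) := by
        cases n with
        | zero => simpa [hq] using tendsto_cutIntegral_inv h₁ h₂ hw l₁ l₂
        | succ n =>
          refine tendsto_const_nhds.congr' ?_
          filter_upwards [eventually_gt_atTop 0, eventually_ge_atTop R] with T hT hTR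
          refine (cutIntegral_eq_zero h₁ h₂ m₁ m₂ hV
            (F := fun s => -((n : ℂ) + 1)⁻¹ * ((s - w) ^ (n + 1))⁻¹)
            (fun s hs => (hqd s hs).continuousAt.continuousWithinAt) (fun s hs => ?_) hT hTR).symm
          have hsw := hVw s hs
          have hn1 : (n : ℂ) + 1 ≠ 0 := by exact_mod_cast n.succ_ne_zero
          have h1 : HasDerivAt (fun s : ℂ => (s - w) ^ (n + 1))
              (((n + 1 : ℕ) : ℂ) * (s - w) ^ n * 1) s := by
            simpa using ((hasDerivAt_id s).sub_const w).fun_pow (n + 1)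
          have h2 := (h1.inv (pow_ne_zero _ hsw)).const_mul (-((n : ℂ) + 1)⁻¹)
          refine h2.congr_deriv ?_
          simp only [hq]
          push_cast
          field_simp
          ring
      have hdslope : AnalyticAt ℂ (dslope g w) w := by
        obtain ⟨p, hp⟩ := hg
        exact hp.has_fpower_series_dslope_fslope.analyticAt
      -- Subtracting g(w)/(z - w)^(n+1) leaves (`dslope g w` z)/(z - w)^n near w, a pole of lower
      -- order.
      have h := ihn (fun s => f s + -g w * q s) (dslope g w) hdslope ?_
        (fun s hs => (hd s hs).add ((hqd s hs).const_mul _))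
        fun v hv => (hmer v hv).add ((MeromorphicAt.const _ v).mul (hqm v))
      · have h' := h.add (hqlim.const_mul (g w))
        rw [mul_zero, add_zero] at h'
        refine h'.congr' ?_
        filter_upwards [eventually_gt_atTop 0] with T hT
        rw [cutIntegral_add_const_mul h₁ h₂ m₁ m₂ hV
          (fun s hs => (hd s hs).continuousAt.continuousWithinAt)
          (fun s hs => (hqd s hs).continuousAt.continuousWithinAt) hT]
        ring
      · filter_upwards [hfg, self_mem_nhdsWithin] with z hz hzw
        have hzw' : z - w ≠ 0 := sub_ne_zero.2 hzw
        have h3 := sub_smul_dslope g w z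
        rw [smul_eq_mul] at h3
        have h4 : g z = g w + (z - w) * dslope g w z := by rw [h3]; ring
        rw [hz, h4]
        simp only [hq, pow_succ]
        field_simp
        ring

end cut

/-! ### Poles of the integrand and independence of the contour -/

def foxLeftPoles (m : ℕ) (lo : List (ℝ × ℝ)) : Set ℂ :=
  {w | ∃ y ∈ lo.take m, ∃ l : ℕ, w = ((-(y.1 + (l : ℝ)) / y.2 : ℝ) : ℂ)}

def foxRightPoles (n : ℕ) (up : List (ℝ × ℝ)) : Set ℂ :=
  {w | ∃ x ∈ up.take n, ∃ l : ℕ, w = (((1 - x.1 + (l : ℝ)) / x.2 : ℝ) : ℂ)}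

theorem isFoxContour_iff {m n : ℕ} {up lo : List (ℝ × ℝ)} {γ : ℝ → ℂ} :
    IsFoxContour m n up lo γ ↔ IsBarnesPath γ ∧ (∀ w ∈ foxLeftPoles m lo, LiesLeftOf w γ) ∧
      ∀ w ∈ foxRightPoles n up, LiesRightOf w γ := by
  refine and_congr_right fun _ => and_congr ?_ ?_
  · constructor
    · rintro h w ⟨y, hy, l, rfl⟩
      exact h y hy l
    · exact fun h y hy l => h _ ⟨y, hy, l, rfl⟩
  · constructor
    · rintro h w ⟨y, hy, l, rfl⟩
      exact h y hy l
    · exact fun h y hy l => h _ ⟨y, hy, l, rfl⟩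

/-- Left poles run to -∞ and right poles to +∞ in finitely many arithmetic progressions, so one edge
of the strip bounds l in each. -/
theorem finite_foxPoles_strip {m n : ℕ} {up lo : List (ℝ × ℝ)} (hup : ∀ x ∈ up, 0 < x.2)
    (hlo : ∀ y ∈ lo, 0 < y.2) (a b : ℝ) :
    ((foxLeftPoles m lo ∪ foxRightPoles n up) ∩ {s | a < s.re ∧ s.re < b}).Finite := by
  have h1 : (⋃ y ∈ {y | y ∈ lo.take m}, (fun l : ℕ => ((-(y.1 + (l : ℝ)) / y.2 : ℝ) : ℂ)) ''
      Set.Iic ⌈-a * y.2 - y.1⌉₊).Finite :=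
    (List.finite_toSet _).biUnion fun y _ => (Set.finite_Iic _).image _
  have h2 : (⋃ x ∈ {x | x ∈ up.take n}, (fun l : ℕ => (((1 - x.1 + (l : ℝ)) / x.2 : ℝ) : ℂ)) ''
      Set.Iic ⌈b * x.2 + x.1 - 1⌉₊).Finite :=
    (List.finite_toSet _).biUnion fun y _ => (Set.finite_Iic _).image _
  refine (h1.union h2).subset ?_
  rintro w ⟨⟨y, hy, l, rfl⟩ | ⟨y, hy, l, rfl⟩, h1, h2⟩
  · refine Or.inl (Set.mem_biUnion (show y ∈ {y | y ∈ lo.take m} from hy) ⟨l, ?_, rfl⟩)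
    have hpos := hlo y (List.mem_of_mem_take hy)
    rw [Complex.ofReal_re, lt_div_iff₀ hpos] at h1
    have : (l : ℝ) ≤ ⌈-a * y.2 - y.1⌉₊ := le_trans (by linarith) (Nat.le_ceil _)
    exact_mod_cast this
  · refine Or.inr (Set.mem_biUnion (show y ∈ {y | y ∈ up.take n} from hy) ⟨l, ?_, rfl⟩)
    have hpos := hup y (List.mem_of_mem_take hy)
    rw [Complex.ofReal_re, div_lt_iff₀ hpos] at h2
    have : (l : ℝ) ≤ ⌈b * y.2 + y.1 - 1⌉₊ := le_trans (by linarith) (Nat.le_ceil _)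
    exact_mod_cast this

theorem im_eq_zero_of_mem_foxPoles {m n : ℕ} {up lo : List (ℝ × ℝ)} {w : ℂ}
    (hw : w ∈ foxLeftPoles m lo ∪ foxRightPoles n up) : w.im = 0 := by
  rcases hw with ⟨y, hy, l, rfl⟩ | ⟨y, hy, l, rfl⟩ <;> exact Complex.ofReal_im _

theorem differentiableAt_list_prod {ι : Type*} (l : List ι) (f : ι → ℂ → ℂ) {s : ℂ}
    (h : ∀ i ∈ l, DifferentiableAt ℂ (f i) s) :
    DifferentiableAt ℂ (fun s => (l.map fun i => f i s).prod) s := by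
  induction l with
  | nil => simp
  | cons i l ih =>
    simp only [List.map_cons, List.prod_cons]
    exact (h i (by simp)).mul (ih fun j hj => h j (by simp [hj]))

theorem meromorphicAt_list_prod {ι : Type*} (l : List ι) (f : ι → ℂ → ℂ) {s : ℂ}
    (h : ∀ i ∈ l, MeromorphicAt (f i) s) :
    MeromorphicAt (fun s => (l.map fun i => f i s).prod) s := by
  induction l with
  | nil => simp
  | cons i l ih =>
    simp only [List.map_cons, List.prod_cons]
    exact (h i (by simp)).mul (ih fun j hj => h j (by simp [hj]))

/-- Γ is the reciprocal of an entire function. -/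
theorem meromorphicAt_Gamma_comp {g : ℂ → ℂ} (hg : Differentiable ℂ g) (s : ℂ) :
    MeromorphicAt (fun s => Complex.Gamma (g s)) s := by
  have h : MeromorphicAt (fun s => ((Complex.Gamma (g s))⁻¹)⁻¹) s :=
    ((Complex.differentiable_one_div_Gamma.comp hg).analyticAt s).meromorphicAt.inv
  simpa using h

theorem meromorphicAt_foxXi (m n : ℕ) (up lo : List (ℝ × ℝ)) (s : ℂ) :
    MeromorphicAt (foxXi m n up lo) s := by
  refine MeromorphicAt.div (MeromorphicAt.mul ?_ ?_) (MeromorphicAt.mul ?_ ?_) <;>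
  exact meromorphicAt_list_prod _ _ fun y _ => meromorphicAt_Gamma_comp (by fun_prop) s

theorem differentiableAt_foxXi {m n : ℕ} {up lo : List (ℝ × ℝ)} (hup : ∀ x ∈ up, 0 < x.2)
    (hlo : ∀ y ∈ lo, 0 < y.2) {s : ℂ} (hs : s ∉ foxLeftPoles m lo ∪ foxRightPoles n up) :
    DifferentiableAt ℂ (foxXi m n up lo) s := by
  rw [funext (foxXi_eq_mul_inv m n up lo)]
  refine ((differentiableAt_list_prod _ _ fun y hy => ?_).mul
    (differentiableAt_list_prod _ _ fun y hy => ?_)).mul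
    ((differentiableAt_list_prod _ _ fun y hy => ?_).mul
    (differentiableAt_list_prod _ _ fun y hy => ?_))
  · refine (Complex.differentiableAt_Gamma _ fun l hl => hs (Or.inl ⟨y, hy, l, ?_⟩)).comp s
      (by fun_prop)
    have hne : (y.2 : ℂ) ≠ 0 := by exact_mod_cast (hlo y (List.mem_of_mem_take hy)).ne'
    push_cast
    rw [eq_div_iff hne]
    linear_combination hl
  · refine (Complex.differentiableAt_Gamma _ fun l hl => hs (Or.inr ⟨y, hy, l, ?_⟩)).comp s
      (by fun_prop)
    have hne : (y.2 : ℂ) ≠ 0 := by exact_mod_cast (hup y (List.mem_of_mem_take hy)).ne'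
    push_cast
    rw [eq_div_iff hne]
    linear_combination -hl
  · exact (Complex.differentiable_one_div_Gamma _).comp
      (f := fun s : ℂ => 1 - (y.1 : ℂ) - (y.2 : ℂ) * s) s (by fun_prop)
  · exact (Complex.differentiable_one_div_Gamma _).comp
      (f := fun s : ℂ => (y.1 : ℂ) + (y.2 : ℂ) * s) s (by fun_prop)

theorem differentiable_const_cpow_neg {z : ℝ} (hz : 0 < z) :
    Differentiable ℂ fun s : ℂ => (z : ℂ) ^ (-s) := fun s =>
  (differentiableAt_id.neg).const_cpow (Or.inl (by exact_mod_cast hz.ne'))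

theorem norm_cpow_neg_le {z K : ℝ} (hz : 0 < z) {s : ℂ} (h1 : -K < s.re) (h2 : s.re < K) :
    ‖(z : ℂ) ^ (-s)‖ ≤ z ^ K + z ^ (-K) := by
  rw [Complex.norm_cpow_eq_rpow_re_of_pos hz, Complex.neg_re]
  have p1 := Real.rpow_pos_of_pos hz K
  have p2 := Real.rpow_pos_of_pos hz (-K)
  rcases le_total 1 z with h | h
  · have := Real.rpow_le_rpow_of_exponent_le h (show -s.re ≤ K by linarith)
    linarith
  · have := Real.rpow_le_rpow_of_exponent_ge hz h (show -K ≤ -s.re by linarith)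
    linarith

theorem integrable_exp_neg_mul_abs {δ : ℝ} (hδ : 0 < δ) :
    MeasureTheory.Integrable fun t : ℝ => Real.exp (-δ * |t|) := by
  have h₁ : MeasureTheory.IntegrableOn (fun t : ℝ => Real.exp (-δ * |t|)) (Set.Ioi 0) :=
    (integrableOn_exp_mul_Ioi (neg_lt_zero.2 hδ) 0).congr_fun
      (fun t ht => by simp only; rw [abs_of_pos (Set.mem_Ioi.1 ht)]) measurableSet_Ioi
  have h₂ : MeasureTheory.IntegrableOn (fun t : ℝ => Real.exp (-δ * |t|)) (Set.Iic 0) :=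
    (integrableOn_exp_mul_Iic hδ 0).congr_fun
      (fun t ht => by
        simp only
        rw [abs_of_nonpos (Set.mem_Iic.1 ht)]
        ring_nf) measurableSet_Iic
  rw [← MeasureTheory.integrableOn_univ, ← Set.Iic_union_Ioi (a := (0 : ℝ))]
  exact h₂.union h₁

section contour

variable {m n : ℕ} {up lo : List (ℝ × ℝ)} {γ : ℝ → ℂ} {a b c R : ℝ}

theorem continuous_foxXi_path (hup : ∀ x ∈ up, 0 < x.2) (hlo : ∀ y ∈ lo, 0 < y.2)
    (hγ : IsFoxContour m n up lo γ) : Continuous fun t => foxXi m n up lo (γ t) := by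
  obtain ⟨hb, hl, hr⟩ := isFoxContour_iff.1 hγ
  refine continuous_iff_continuousAt.2 fun t => ?_
  refine ContinuousAt.comp (f := γ) (differentiableAt_foxXi hup hlo ?_).continuousAt
    hb.1.continuousAt
  rintro (h | h)
  · exact (hl _ h).1 t rfl
  · exact (hr _ h).1 t rfl

theorem exists_foxXi_path_bound (hup : ∀ x ∈ up, 0 < x.2) (hlo : ∀ y ∈ lo, 0 < y.2)
    (hχ : 0 < foxChi m n up lo) (hγ : IsFoxContour m n up lo γ) (hs : StripPath γ a b c R) :
    ∃ C δ : ℝ, 0 < δ ∧ ∀ t, ‖foxXi m n up lo (γ t)‖ ≤ C * Real.exp (-δ * |t|) := by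
  have hpi := Real.pi_pos
  set κ := Real.pi / 2 * foxChi m n up lo
  have hκ : 0 < κ := by positivity
  obtain ⟨C, T, hC, h⟩ := (stripBound_foxXi (m := m) (n := n) hup hlo a b).exp_decay hκ
  set T' := max T R
  obtain ⟨D, hD⟩ := (isCompact_Icc (a := -T') (b := T')).exists_bound_of_continuousOn
    (continuous_foxXi_path hup hlo hγ).continuousOn
  -- The factor exp(κT'/2) makes the second term at least |D| on the compact part |t| ≤ T'.
  refine ⟨C + |D| * Real.exp (κ / 2 * T'), κ / 2, by positivity, fun t => ?_⟩
  rw [add_mul]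
  rcases le_total T' |t| with ht | ht
  · have him : (γ t).im = t := by rw [hs.tail t ((le_max_right _ _).trans ht)]; simp
    have := h (γ t) (hs.mem t).1.le (hs.mem t).2.le (by
      rw [him]; exact (le_max_left _ _).trans ht)
    rw [him] at this
    have : 0 ≤ |D| * Real.exp (κ / 2 * T') * Real.exp (-(κ / 2) * |t|) := by positivity
    linarith
  · have h1 := hD t (abs_le.1 ht)
    have h2 : 1 ≤ Real.exp (κ / 2 * T') * Real.exp (-(κ / 2) * |t|) := by
      rw [← Real.exp_add]
      refine Real.one_le_exp ?_
      nlinarith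
    have h3 : 0 ≤ C * Real.exp (-(κ / 2) * |t|) := by positivity
    have h4 : |D| * 1 ≤ |D| * (Real.exp (κ / 2 * T') * Real.exp (-(κ / 2) * |t|)) := by gcongr
    have := le_abs_self D
    linarith

theorem integrable_barnes (hup : ∀ x ∈ up, 0 < x.2) (hlo : ∀ y ∈ lo, 0 < y.2)
    (hχ : 0 < foxChi m n up lo) (hγ : IsFoxContour m n up lo γ) {z : ℝ} (hz : 0 < z) :
    MeasureTheory.Integrable fun t : ℝ =>
      foxXi m n up lo (γ t) * (z : ℂ) ^ (-γ t) * deriv γ t := by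
  obtain ⟨K, c, R, hs⟩ := hγ.1.exists_stripPath
  obtain ⟨C, δ, hδ, h⟩ := exists_foxXi_path_bound hup hlo hχ hγ hs
  obtain ⟨M, hM⟩ := hs.bound
  refine ((integrable_exp_neg_mul_abs hδ).const_mul (C * (z ^ K + z ^ (-K)) * M)).mono' ?_ ?_
  · refine ((continuous_foxXi_path hup hlo hγ).mul ?_).aestronglyMeasurable.mul
      (measurable_deriv γ).aestronglyMeasurable
    exact (differentiable_const_cpow_neg hz).continuous.comp hs.cont
  · refine Eventually.of_forall fun t => ?_
    rw [norm_mul, norm_mul]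
    have h1 := norm_cpow_neg_le hz (hs.mem t).1 (hs.mem t).2
    have h2 := h t
    have h3 := hM t
    have h4 : 0 ≤ C * Real.exp (-δ * |t|) := (norm_nonneg _).trans h2
    have h5 : 0 ≤ z ^ K + z ^ (-K) := by positivity
    calc _ ≤ C * Real.exp (-δ * |t|) * (z ^ K + z ^ (-K)) * M := by gcongr
      _ = _ := by ring

/-- Both contours lie in one strip with finitely many poles and have the same index at each.
Cauchy's theorem applies, and the horizontal segments vanish in the limit by the decay for χ > 0. -/
theorem barnesIntegral_eq_of_isFoxContour (hup : ∀ x ∈ up, 0 < x.2) (hlo : ∀ y ∈ lo, 0 < y.2)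
    (hχ : 0 < foxChi m n up lo) {γ₁ γ₂ : ℝ → ℂ} (h₁ : IsFoxContour m n up lo γ₁)
    (h₂ : IsFoxContour m n up lo γ₂) {z : ℝ} (hz : 0 < z) :
    barnesIntegral m n up lo γ₁ z = barnesIntegral m n up lo γ₂ z := by
  obtain ⟨K₁, c₁, R₁, s₁⟩ := h₁.1.exists_stripPath
  obtain ⟨K₂, c₂, R₂, s₂⟩ := h₂.1.exists_stripPath
  set K := max K₁ K₂
  replace s₁ : StripPath γ₁ (-K) K c₁ (max R₁ R₂) :=
    s₁.mono (neg_le_neg (le_max_left _ _)) (le_max_left _ _) (le_max_left _ _)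
  replace s₂ : StripPath γ₂ (-K) K c₂ (max R₁ R₂) :=
    s₂.mono (neg_le_neg (le_max_right _ _)) (le_max_right _ _) (le_max_right _ _)
  set f : ℂ → ℂ := fun s => foxXi m n up lo s * (z : ℂ) ^ (-s) with hf
  have hfin := finite_foxPoles_strip (m := m) (n := n) hup hlo (-K) K
  have hcauchy := tendsto_cutIntegral s₁ s₂ hfin.toFinset ?_ f ?_ ?_
  · have hpi := Real.pi_pos
    have hκ : 0 < Real.pi / 2 * foxChi m n up lo := by positivity
    obtain ⟨C, T, hC, hdec⟩ := (stripBound_foxXi (m := m) (n := n) hup hlo (-K) K).exp_decay hκ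
    have hor := tendsto_horizontal (f := f) s₁ s₂ (T₀ := T)
      (e := fun t => C * Real.exp (-(Real.pi / 2 * foxChi m n up lo / 2) * t) *
        (z ^ K + z ^ (-K))) ?_ fun s hs1 hs2 hs3 => ?_
    · have l₁ := MeasureTheory.intervalIntegral_tendsto_integral
        (integrable_barnes hup hlo hχ h₁ hz) tendsto_neg_atTop_atBot tendsto_id
      have l₂ := MeasureTheory.intervalIntegral_tendsto_integral
        (integrable_barnes hup hlo hχ h₂ hz) tendsto_neg_atTop_atBot tendsto_id
      have h0 : Tendsto (fun T : ℝ => (∫ t in (-T)..T, f (γ₁ t) * deriv γ₁ t)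
          - ∫ t in (-T)..T, f (γ₂ t) * deriv γ₂ t) atTop (𝓝 (0 - 0)) := by
        refine (hcauchy.sub hor).congr fun T => ?_
        simp only [cutIntegral]
        ring
      have := tendsto_nhds_unique h0 (l₁.sub l₂)
      rw [sub_zero] at this
      simp only [barnesIntegral]
      rw [sub_eq_zero.1 this.symm]
    · have : Tendsto (fun t : ℝ => Real.exp (-(Real.pi / 2 * foxChi m n up lo / 2) * t))
          atTop (𝓝 0) :=
        Real.tendsto_exp_atBot.comp (tendsto_id.const_mul_atTop_of_neg (by linarith))
      simpa using (this.const_mul C).mul_const (z ^ K + z ^ (-K))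
    · rw [hf, norm_mul]
      exact mul_le_mul (hdec s hs1.le hs2.le hs3) (norm_cpow_neg_le hz hs1 hs2) (norm_nonneg _)
        (by positivity)
  · intro w hw
    rw [Set.Finite.mem_toFinset] at hw
    refine ⟨im_eq_zero_of_mem_foxPoles hw.1, ?_⟩
    obtain ⟨-, hl₁, hr₁⟩ := isFoxContour_iff.1 h₁
    obtain ⟨-, hl₂, hr₂⟩ := isFoxContour_iff.1 h₂
    rcases hw.1 with h | h
    · exact ⟨(hl₁ w h).1, (hl₂ w h).1, _, (hl₁ w h).2, (hl₂ w h).2⟩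
    · exact ⟨(hr₁ w h).1, (hr₂ w h).1, _, (hr₁ w h).2, (hr₂ w h).2⟩
  · intro s hs1 hs2 hs3
    refine (differentiableAt_foxXi hup hlo fun h => hs3 ?_).mul
      (differentiable_const_cpow_neg hz s)
    exact hfin.mem_toFinset.2 ⟨h, hs1, hs2⟩
  · intro w _
    exact (meromorphicAt_foxXi m n up lo w).mul
      ((differentiable_const_cpow_neg hz).analyticAt w).meromorphicAt

theorem foxH_eq_barnesIntegral (hup : ∀ x ∈ up, 0 < x.2) (hlo : ∀ y ∈ lo, 0 < y.2)
    (hχ : 0 < foxChi m n up lo) (hγ : IsFoxContour m n up lo γ) {z : ℝ} (hz : 0 < z) :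
    foxH m n up lo z = barnesIntegral m n up lo γ z := by
  have h : ∃ γ : ℝ → ℂ, IsFoxContour m n up lo γ := ⟨γ, hγ⟩
  rw [foxH, dif_pos h]
  exact barnesIntegral_eq_of_isFoxContour hup hlo hχ h.choose_spec hγ hz

end contour

/-! ### Squashing a contour to the left -/

/-- A `C¹` function that fixes `(-∞, c₀]` and maps `[c₀, ∞)` into `[c₀, c₁]`. -/
theorem exists_contDiff_squash {c₀ c₁ : ℝ} (h : c₀ < c₁) :
    ∃ φ : ℝ → ℝ, ContDiff ℝ 1 φ ∧ (∀ x ≤ c₀, φ x = x) ∧ (∀ x, φ x ≤ c₁) ∧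
      ∀ x, c₀ ≤ x → c₀ ≤ φ x := by
  have hd : 0 < c₁ - c₀ := sub_pos.2 h
  -- This is (1 - η)x + ηc₁, with η rising smoothly from 0 at c₀ to 1 at c₁.
  refine ⟨fun x => x + Real.smoothTransition ((x - c₀) / (c₁ - c₀)) * (c₁ - x), ?_, ?_, ?_, ?_⟩
  · have : ContDiff ℝ 1 Real.smoothTransition := Real.smoothTransition.contDiff
    fun_prop
  · intro x hx
    simp only
    rw [Real.smoothTransition.zero_of_nonpos (div_nonpos_of_nonpos_of_nonneg (by linarith) hd.le)]
    ring
  · intro x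
    rcases le_total x c₁ with hx | hx
    · nlinarith [Real.smoothTransition.le_one ((x - c₀) / (c₁ - c₀))]
    · simp only
      rw [Real.smoothTransition.one_of_one_le ((one_le_div hd).2 (by linarith))]
      linarith
  · intro x hx
    rcases le_total x c₁ with hx' | hx'
    · nlinarith [Real.smoothTransition.nonneg ((x - c₀) / (c₁ - c₀))]
    · simp only
      rw [Real.smoothTransition.one_of_one_le ((one_le_div hd).2 (by linarith))]
      linarith

/-- The path obtained from `γ` by applying `φ` to the real part. -/
noncomputable def squashPath (φ : ℝ → ℝ) (γ : ℝ → ℂ) (t : ℝ) : ℂ :=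
  (φ (γ t).re : ℂ) + ((γ t).im : ℂ) * Complex.I

@[simp] theorem squashPath_re (φ : ℝ → ℝ) (γ : ℝ → ℂ) (t : ℝ) :
    (squashPath φ γ t).re = φ (γ t).re := by simp [squashPath]

@[simp] theorem squashPath_im (φ : ℝ → ℝ) (γ : ℝ → ℂ) (t : ℝ) :
    (squashPath φ γ t).im = (γ t).im := by simp [squashPath]

theorem isBarnesPath_squashPath {φ : ℝ → ℝ} (hφ : ContDiff ℝ 1 φ) {γ : ℝ → ℂ}
    (hγ : IsBarnesPath γ) : IsBarnesPath (squashPath φ γ) := by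
  obtain ⟨K, c, R, h⟩ := hγ.exists_stripPath
  obtain ⟨br, hbr⟩ := h.smooth
  obtain ⟨M, hM⟩ := h.bound
  have hφc : Continuous φ := hφ.continuous
  have hφ' : Continuous (deriv φ) := hφ.continuous_deriv le_rfl
  obtain ⟨D, hD⟩ := (isCompact_Icc (a := -K) (b := K)).exists_bound_of_continuousOn
    hφ'.continuousOn
  have hcont : Continuous γ := h.cont
  refine ⟨?_, ⟨br, fun t ht => ?_⟩, ?_, φ c, R, fun t ht => ?_⟩
  · unfold squashPath
    fun_prop
  · have h1 : ContDiffAt ℝ 1 γ t := hbr t ht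
    have hre : ContDiffAt ℝ 1 (fun t => (γ t).re) t :=
      Complex.reCLM.contDiff.contDiffAt.comp t h1
    have him : ContDiffAt ℝ 1 (fun t => (γ t).im) t :=
      Complex.imCLM.contDiff.contDiffAt.comp t h1
    have h2 : ContDiffAt ℝ 1 (fun t => φ (γ t).re) t := hφ.contDiffAt.comp t hre
    exact (Complex.ofRealCLM.contDiff.contDiffAt.comp t h2).add
      ((Complex.ofRealCLM.contDiff.contDiffAt.comp t him).mul contDiffAt_const)
  -- The finite sum covers the break points, where the chain rule gives no information on the
  -- derivative.
  · refine ⟨|D| * M + M + ∑ t ∈ br, ‖deriv (squashPath φ γ) t‖, fun t => ?_⟩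
    have hM0 : 0 ≤ M := (norm_nonneg _).trans (hM 0)
    have hsum : 0 ≤ ∑ t ∈ br, ‖deriv (squashPath φ γ) t‖ :=
      Finset.sum_nonneg fun _ _ => norm_nonneg _
    by_cases ht : t ∈ br
    · have := Finset.single_le_sum (f := fun t => ‖deriv (squashPath φ γ) t‖)
        (fun _ _ => norm_nonneg _) ht
      have : 0 ≤ |D| * M := by positivity
      linarith
    · have h1 : HasDerivAt γ (deriv γ t) t :=
        ((hbr t ht).differentiableAt one_ne_zero).hasDerivAt
      have hre : HasDerivAt (fun t => (γ t).re) (deriv γ t).re t :=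
        Complex.reCLM.hasFDerivAt.comp_hasDerivAt t h1
      have him : HasDerivAt (fun t => (γ t).im) (deriv γ t).im t :=
        Complex.imCLM.hasFDerivAt.comp_hasDerivAt t h1
      have h2 : HasDerivAt (fun t => φ (γ t).re) (deriv φ (γ t).re * (deriv γ t).re) t :=
        ((hφ.differentiable one_ne_zero) _).hasDerivAt.comp t hre
      have h3 : HasDerivAt (squashPath φ γ)
          (((deriv φ (γ t).re * (deriv γ t).re : ℝ) : ℂ) +
            ((deriv γ t).im : ℂ) * Complex.I) t :=
        h2.ofReal_comp.add (him.ofReal_comp.mul_const _)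
      rw [h3.deriv]
      refine (norm_add_le _ _).trans ?_
      rw [norm_mul, Complex.norm_I, mul_one, Complex.norm_real, Complex.norm_real, norm_mul]
      have e1 : ‖deriv φ (γ t).re‖ ≤ |D| :=
        (hD _ ⟨(h.mem t).1.le, (h.mem t).2.le⟩).trans (le_abs_self _)
      have e2 : ‖(deriv γ t).re‖ ≤ M := (Complex.abs_re_le_norm _).trans (hM t)
      have e3 : ‖(deriv γ t).im‖ ≤ M := (Complex.abs_im_le_norm _).trans (hM t)
      have e4 : ‖deriv φ (γ t).re‖ * ‖(deriv γ t).re‖ ≤ |D| * M := by gcongr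
      linarith
  · simp [squashPath, h.tail t ht]

/-- Dividing both arguments by T > 0 does not change the difference; they then tend to -i and i,
where log is continuous. -/
theorem tendsto_log_sub_log (d : ℝ) :
    Tendsto (fun T : ℝ => Complex.log ((d : ℂ) - T * Complex.I) -
      Complex.log ((d : ℂ) + T * Complex.I)) atTop (𝓝 (-((Real.pi : ℂ) * Complex.I))) := by
  have hd : Tendsto (fun T : ℝ => ((d / T : ℝ) : ℂ)) atTop (𝓝 ((0 : ℝ) : ℂ)) :=
    (Complex.continuous_ofReal.tendsto 0).comp (tendsto_const_nhds.div_atTop tendsto_id)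
  rw [Complex.ofReal_zero] at hd
  have h1 : Tendsto (fun T : ℝ => Complex.log (((d / T : ℝ) : ℂ) + -Complex.I)) atTop
      (𝓝 (Complex.log (-Complex.I))) := by
    refine (continuousAt_clog (by simp [Complex.mem_slitPlane_iff])).tendsto.comp ?_
    simpa using hd.add_const (-Complex.I)
  have h2 : Tendsto (fun T : ℝ => Complex.log (((d / T : ℝ) : ℂ) + Complex.I)) atTop
      (𝓝 (Complex.log Complex.I)) := by
    refine (continuousAt_clog (by simp [Complex.mem_slitPlane_iff])).tendsto.comp ?_
    simpa using hd.add_const Complex.I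
  have h3 := h1.sub h2
  rw [Complex.log_neg_I, Complex.log_I] at h3
  have e : -(Real.pi / 2 : ℂ) * Complex.I - Real.pi / 2 * Complex.I
      = -((Real.pi : ℂ) * Complex.I) := by ring
  rw [e] at h3
  refine h3.congr' ?_
  filter_upwards [eventually_gt_atTop 0] with T hT
  have hT' : (T : ℂ) ≠ 0 := by exact_mod_cast hT.ne'
  have n1 : ((d / T : ℝ) : ℂ) + -Complex.I ≠ 0 := fun h => by
    simpa using congrArg Complex.im h
  have n2 : ((d / T : ℝ) : ℂ) + Complex.I ≠ 0 := fun h => by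
    simpa using congrArg Complex.im h
  have e1 : (d : ℂ) - T * Complex.I = (T : ℂ) * (((d / T : ℝ) : ℂ) + -Complex.I) := by
    push_cast
    field_simp
    ring
  have e2 : (d : ℂ) + T * Complex.I = (T : ℂ) * (((d / T : ℝ) : ℂ) + Complex.I) := by
    push_cast
    field_simp
  rw [e1, e2, Complex.log_ofReal_mul hT n1, Complex.log_ofReal_mul hT n2]
  ring

/-- w - γ stays in the right half-plane, so log(w - γ) is a primitive of the integrand along the
path. -/
theorem liesRightOf_of_re_lt {γ : ℝ → ℂ} (hγ : IsBarnesPath γ) {w : ℂ} (hw : w.im = 0)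
    (h : ∀ t, (γ t).re < w.re) : LiesRightOf w γ := by
  obtain ⟨K, c, R, hs⟩ := hγ.exists_stripPath
  have hne : ∀ t, γ t ≠ w := fun t ht => (h t).ne (by rw [ht])
  have hcont : Continuous γ := hs.cont
  obtain ⟨br, hbr⟩ := hs.smooth
  refine ⟨hne, ?_⟩
  have hlim := tendsto_log_sub_log (w.re - c)
  refine hlim.congr' ?_
  filter_upwards [eventually_ge_atTop R] with T hT
  have hslit : ∀ t, w - γ t ∈ Complex.slitPlane := fun t => by
    rw [Complex.mem_slitPlane_iff]
    left
    simpa using h t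
  have hint : IntervalIntegrable (fun t => deriv γ t / (γ t - w)) MeasureTheory.volume (-T) T := by
    have := hs.intervalIntegrable (f := fun s => (s - w)⁻¹)
      ((hcont.sub continuous_const).inv₀ fun t => sub_ne_zero.2 (hne t)) (-T) T
    refine this.congr (fun t _ => ?_)
    simp only [div_eq_mul_inv, mul_comm]
  have hFTC := MeasureTheory.integral_eq_of_hasDerivAt_off_countable
    (fun t => Complex.log (w - γ t)) (fun t => deriv γ t / (γ t - w)) (a := -T) (b := T)
    br.countable_toSet ?_ (fun t ht => ?_) hint
  · have hw' : w = (w.re : ℂ) := Complex.ext (by simp) (by simp [hw])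
    rw [hFTC, hs.tail T (hT.trans (le_abs_self T)),
      hs.tail (-T) (by rw [abs_neg]; exact hT.trans (le_abs_self T))]
    conv_rhs => rw [hw']
    push_cast
    congr 2 <;> ring
  · exact ((continuous_const.sub hcont).clog hslit).continuousOn
  · have h1 : HasDerivAt γ (deriv γ t) t :=
      ((hbr t ht.2).differentiableAt one_ne_zero).hasDerivAt
    have h2 := (h1.const_sub w).clog_real (hslit t)
    refine h2.congr_deriv ?_
    rw [← neg_sub (γ t) w, neg_div_neg_eq]

/-- For equal imaginary parts, Re(v/u) = (Re v Re u + (Im u)²)/|u|². -/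
theorem div_mem_slitPlane {u v : ℂ} (hu : u ≠ 0) (him : u.im = v.im)
    (h : v = u ∨ 0 < u.re ∧ 0 < v.re) : v / u ∈ Complex.slitPlane := by
  rw [Complex.mem_slitPlane_iff]
  left
  rcases h with rfl | ⟨h1, h2⟩
  · simp [hu]
  · rw [Complex.div_re, him]
    have : 0 < Complex.normSq u := Complex.normSq_pos.2 hu
    have h3 : 0 < v.re * u.re / Complex.normSq u := by positivity
    have h4 : 0 ≤ v.im * v.im / Complex.normSq u := div_nonneg (mul_self_nonneg _) this.le
    linarith

/-- Squashing a path to the right of `w` does not change its index with respect to `w`. -/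
theorem index_squashPath {φ : ℝ → ℝ} {c₀ : ℝ} (hφ : ContDiff ℝ 1 φ) (hid : ∀ x ≤ c₀, φ x = x)
    (hge : ∀ x, c₀ ≤ x → c₀ ≤ φ x) {γ : ℝ → ℂ} (hγ : IsBarnesPath γ) {w : ℂ}
    (hwc : w.re < c₀) (hne : ∀ t, γ t ≠ w) {L : ℂ}
    (hL : Tendsto (fun T : ℝ => ∫ t in (-T)..T, deriv γ t / (γ t - w)) atTop (𝓝 L)) :
    (∀ t, squashPath φ γ t ≠ w) ∧ Tendsto (fun T : ℝ => ∫ t in (-T)..T,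
      deriv (squashPath φ γ) t / (squashPath φ γ t - w)) atTop (𝓝 L) := by
  set γ' := squashPath φ γ with hγ'def
  have hγ' : IsBarnesPath γ' := isBarnesPath_squashPath hφ hγ
  have halt : ∀ t, γ' t = γ t ∨ c₀ ≤ (γ t).re ∧ c₀ ≤ (γ' t).re := by
    intro t
    rcases le_total (γ t).re c₀ with h | h
    · left
      apply Complex.ext <;> simp [hγ'def, hid _ h]
    · right
      exact ⟨h, by simpa [hγ'def] using hge _ h⟩
  have hne' : ∀ t, γ' t ≠ w := by
    intro t ht
    rcases halt t with h | h
    · exact hne t (by rw [← h, ht])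
    · rw [ht] at h
      linarith
  refine ⟨hne', ?_⟩
  obtain ⟨K, c, R, hs⟩ := hγ.exists_stripPath
  obtain ⟨K', c', R', hs'⟩ := hγ'.exists_stripPath
  have hcont : Continuous γ := hs.cont
  have hcont' : Continuous γ' := hs'.cont
  obtain ⟨br, hbr⟩ := hs.smooth
  obtain ⟨br', hbr'⟩ := hs'.smooth
  have hslit : ∀ t, (γ' t - w) / (γ t - w) ∈ Complex.slitPlane := fun t => by
    refine div_mem_slitPlane (sub_ne_zero.2 (hne t)) (by simp [hγ'def]) ?_
    rcases halt t with h | h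
    · left; rw [h]
    · right
      rw [Complex.sub_re, Complex.sub_re]
      exact ⟨by linarith, by linarith⟩
  -- log q is a primitive of the difference of the two index integrands. It tends to 0 at both ends,
  -- where q - 1 = (c' - c)/(γ - w), so the limits agree.
  set q : ℝ → ℂ := fun t => (γ' t - w) / (γ t - w) with hq
  have hqc : Continuous q :=
    (hcont'.sub continuous_const).div (hcont.sub continuous_const) fun t => sub_ne_zero.2 (hne t)
  have hint : ∀ T, IntervalIntegrable (fun t => deriv γ t / (γ t - w))
      MeasureTheory.volume (-T) T := fun T => by
    refine (hs.intervalIntegrable (f := fun s => (s - w)⁻¹)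
      ((hcont.sub continuous_const).inv₀ fun t => sub_ne_zero.2 (hne t)) (-T) T).congr
      (fun t _ => ?_)
    simp only [div_eq_mul_inv, mul_comm]
  have hint' : ∀ T, IntervalIntegrable (fun t => deriv γ' t / (γ' t - w))
      MeasureTheory.volume (-T) T := fun T => by
    refine (hs'.intervalIntegrable (f := fun s => (s - w)⁻¹)
      ((hcont'.sub continuous_const).inv₀ fun t => sub_ne_zero.2 (hne' t)) (-T) T).congr
      (fun t _ => ?_)
    simp only [div_eq_mul_inv, mul_comm]
  have hFTC : ∀ T, (∫ t in (-T)..T, (deriv γ' t / (γ' t - w) - deriv γ t / (γ t - w)))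
      = Complex.log (q T) - Complex.log (q (-T)) := fun T => by
    refine MeasureTheory.integral_eq_of_hasDerivAt_off_countable
      (fun t => Complex.log (q t)) _ (br ∪ br').countable_toSet
      (hqc.clog hslit).continuousOn (fun t ht => ?_) ((hint' T).sub (hint T))
    have ht2 := ht.2
    simp only [Finset.coe_union, Set.mem_union, Finset.mem_coe, not_or] at ht2
    have h1 : HasDerivAt γ (deriv γ t) t :=
      ((hbr t ht2.1).differentiableAt one_ne_zero).hasDerivAt
    have h1' : HasDerivAt γ' (deriv γ' t) t :=
      ((hbr' t ht2.2).differentiableAt one_ne_zero).hasDerivAt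
    have h2 := ((h1'.sub_const w).fun_div (h1.sub_const w) (sub_ne_zero.2 (hne t))).clog_real
      (hslit t)
    refine h2.congr_deriv ?_
    have e1 := sub_ne_zero.2 (hne t)
    have e2 := sub_ne_zero.2 (hne' t)
    field_simp
  have hq1 : ∀ t : ℝ, max R R' ≤ |t| → |w.im| < |t| →
      ‖q t - 1‖ ≤ ‖((c' : ℂ) - c)‖ / (|t| - |w.im|) := by
    intro t ht htw
    have e := sub_ne_zero.2 (hne t)
    have e3 : q t - 1 = ((c' : ℂ) - c) / (γ t - w) := by
      rw [hq, eq_div_iff e, sub_mul, div_mul_cancel₀ _ e,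
        hs.tail t ((le_max_left _ _).trans ht), hs'.tail t ((le_max_right _ _).trans ht)]
      ring
    have him : (γ t - w).im = t - w.im := by
      rw [hs.tail t ((le_max_left _ _).trans ht)]
      simp
    rw [e3, norm_div]
    refine div_le_div_of_nonneg_left (norm_nonneg _) (sub_pos.2 htw) ?_
    calc |t| - |w.im| ≤ |t - w.im| := abs_sub_abs_le_abs_sub _ _
      _ = |(γ t - w).im| := by rw [him]
      _ ≤ _ := Complex.abs_im_le_norm _
  have hlim : ∀ u : ℝ → ℝ, Tendsto (fun T => |u T|) atTop atTop →
      Tendsto (fun T => Complex.log (q (u T))) atTop (𝓝 0) := by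
    intro u hu
    have h1 : Tendsto (fun T => q (u T) - 1) atTop (𝓝 0) := by
      refine squeeze_zero_norm' ?_ ((tendsto_const_nhds (x := ‖((c' : ℂ) - c)‖)).div_atTop
        (tendsto_atTop_add_const_right _ (-|w.im|) hu))
      filter_upwards [hu.eventually_ge_atTop (max R R'), hu.eventually_gt_atTop |w.im|]
        with T h1 h2 using hq1 _ h1 h2
    have h2 : Tendsto (fun T => q (u T)) atTop (𝓝 1) := by simpa using h1.add_const 1
    have h3 := (continuousAt_clog Complex.one_mem_slitPlane).tendsto.comp h2
    rwa [Complex.log_one] at h3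
  have h0 := (hlim id tendsto_abs_atTop_atTop).sub (hlim (fun T => -T)
    (by simpa using tendsto_abs_atTop_atTop))
  rw [sub_zero] at h0
  have h3 := hL.add h0
  rw [add_zero] at h3
  refine h3.congr fun T => ?_
  simp only [id]
  rw [← hFTC, intervalIntegral.integral_sub (hint' T) (hint T)]
  ring

theorem eventually_nhdsGT_forall_lt {F : Set ℝ} (hF : F.Finite) (M : ℝ) :
    ∀ᶠ x in 𝓝[>] M, ∀ f ∈ F, M < f → x < f := by
  rw [Filter.eventually_all_finite hF]
  intro f _
  by_cases h : M < f
  · filter_upwards [Ioo_mem_nhdsGT h] with x hx _ using hx.2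
  · exact Eventually.of_forall fun x hx => absurd hx h

/-- A contour can be chosen to the left of any `σ` that is to the right of all left poles. -/
theorem exists_isFoxContour_re_le {m n : ℕ} {up lo : List (ℝ × ℝ)} (hup : ∀ x ∈ up, 0 < x.2)
    (hlo : ∀ y ∈ lo, 0 < y.2) {γ : ℝ → ℂ} (hγ : IsFoxContour m n up lo γ) {M σ : ℝ}
    (hMσ : M < σ) (hM : ∀ w ∈ foxLeftPoles m lo, w.re ≤ M) :
    ∃ γ' : ℝ → ℂ, IsFoxContour m n up lo γ' ∧ ∃ c₁ < σ, ∀ t, (γ' t).re ≤ c₁ := by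
  obtain ⟨hb, hl, hr⟩ := isFoxContour_iff.1 hγ
  have hfin := (finite_foxPoles_strip (m := m) (n := n) hup hlo M σ).image Complex.re
  -- No right pole has real part in (M, c₁], and all left poles have real part at most M, so
  -- squashing into Re s ≤ c₁ crosses no left pole.
  obtain ⟨c₁, h1, h2⟩ := ((eventually_nhdsGT_forall_lt hfin M).and (Ioo_mem_nhdsGT hMσ)).exists
  have hc : (M + c₁) / 2 < c₁ := by linarith [h2.1]
  have hMc : M < (M + c₁) / 2 := by linarith [h2.1]
  obtain ⟨φ, hφ, hid, hle, hge⟩ := exists_contDiff_squash hc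
  refine ⟨squashPath φ γ, isFoxContour_iff.2 ⟨isBarnesPath_squashPath hφ hb, fun w hw => ?_,
    fun w hw => ?_⟩, c₁, h2.2, fun t => by simpa using hle _⟩
  · exact index_squashPath hφ hid hge hb ((hM w hw).trans_lt hMc) (hl w hw).1 (hl w hw).2
  · rcases le_or_gt w.re M with h | h
    · exact index_squashPath hφ hid hge hb (h.trans_lt hMc) (hr w hw).1 (hr w hw).2
    · refine liesRightOf_of_re_lt (isBarnesPath_squashPath hφ hb)
        (im_eq_zero_of_mem_foxPoles (Or.inr hw : w ∈ foxLeftPoles m lo ∪ foxRightPoles n up))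
        fun t => ?_
      rw [squashPath_re]
      refine (hle _).trans_lt ?_
      rcases le_or_gt σ w.re with h' | h'
      · exact h2.2.trans_le h'
      · exact h1 _ ⟨w, ⟨Or.inr hw, h, h'⟩, rfl⟩ h

/-! ### One Euler beta step -/

open MeasureTheory

section beta

variable {m n : ℕ} {up lo : List (ℝ × ℝ)} {a₁ a₂ b₁ b₂ : ℝ}

theorem foxMinRatio_mul_le (hlo : ∀ y ∈ lo, 0 < y.2) {y : ℝ × ℝ} (hy : y ∈ lo.take m) :
    foxMinRatio m lo * y.2 ≤ y.1 := by
  have hpos := hlo y (List.mem_of_mem_take hy)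
  rw [← le_div_iff₀ hpos]
  exact csInf_le ((List.finite_toSet _).image _).bddBelow ⟨y, hy, rfl⟩

theorem re_le_of_mem_foxLeftPoles (hlo : ∀ y ∈ lo, 0 < y.2) {w : ℂ}
    (hw : w ∈ foxLeftPoles m lo) : w.re ≤ -foxMinRatio m lo := by
  obtain ⟨y, hy, l, rfl⟩ := hw
  have h := foxMinRatio_mul_le hlo hy
  rw [Complex.ofReal_re, div_le_iff₀ (hlo y (List.mem_of_mem_take hy))]
  have : (0 : ℝ) ≤ l := Nat.cast_nonneg l
  linarith

/-- Left poles have real part at most -μ, where μ is the minimal ratio, while the new right poles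
(a₁ + l')/a₂ exceed -μ. -/
theorem ne_of_foxMinRatio (hlo : ∀ y ∈ lo, 0 < y.2) (ha₂ : 0 < a₂)
    (ha : 0 < a₁ + a₂ * foxMinRatio m lo) {y : ℝ × ℝ} (hy : y ∈ lo.take m) (l l' : ℕ) :
    a₂ * ((l : ℝ) + y.1) ≠ y.2 * ((1 - a₁) - (l' : ℝ) - 1) := by
  have h := foxMinRatio_mul_le hlo hy
  have hpos := hlo y (List.mem_of_mem_take hy)
  have hl : (0 : ℝ) ≤ l := Nat.cast_nonneg l
  have hl' : (0 : ℝ) ≤ l' := Nat.cast_nonneg l'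
  refine ne_of_gt ?_
  have h1 : 0 ≤ a₂ * l := by positivity
  have h2 : 0 ≤ y.2 * l' := by positivity
  have h3 : 0 ≤ a₂ * (y.1 - foxMinRatio m lo * y.2) := mul_nonneg ha₂.le (by linarith)
  have h4 : 0 < y.2 * (a₁ + a₂ * foxMinRatio m lo) := by positivity
  nlinarith

theorem FoxAdmissible.euler_step (h : FoxAdmissible m n up lo) (ha₂ : 0 < a₂) (hb₂ : 0 < b₂)
    (ha : 0 < a₁ + a₂ * foxMinRatio m lo) (hb : 0 < b₁ + b₂ * foxMinRatio m lo) :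
    FoxAdmissible m (n + 2) ((1 - a₁, a₂) :: (1 - b₁, b₂) :: up)
      (lo ++ [(1 - a₁ - b₁, a₂ + b₂)]) where
  n_le := by simpa using h.n_le
  m_le := by simpa using h.m_le.trans (Nat.le_succ _)
  up_pos := by simpa using ⟨ha₂, hb₂, fun x y hx => h.up_pos (x, y) hx⟩
  lo_pos := by
    intro y hy
    rcases List.mem_append.1 hy with hy | hy
    · exact h.lo_pos y hy
    · rw [List.mem_singleton.1 hy]
      exact add_pos ha₂ hb₂
  poles_ne := by
    intro x hx y hy
    rw [List.take_append_of_le_length h.m_le] at hy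
    simp only [List.take_succ_cons, List.mem_cons] at hx
    rcases hx with rfl | rfl | hx
    · exact ne_of_foxMinRatio h.lo_pos ha₂ ha hy
    · exact ne_of_foxMinRatio h.lo_pos hb₂ hb hy
    · exact h.poles_ne x hx y hy

/-- The added pairs contribute a₂ + b₂ - (a₂ + b₂) = 0. -/
theorem foxChi_euler_step (hm : m ≤ lo.length) :
    foxChi m (n + 2) ((1 - a₁, a₂) :: (1 - b₁, b₂) :: up) (lo ++ [(1 - a₁ - b₁, a₂ + b₂)])
      = foxChi m n up lo := by
  simp only [foxChi, List.take_append_of_le_length hm, List.drop_append_of_le_length hm,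
    List.take_succ_cons, List.drop_succ_cons, List.map_append, List.map_cons, List.sum_append,
    List.sum_cons, List.map_nil, List.sum_nil]
  ring

/-- The new factors are Γ(u)Γ(v)/Γ(u + v) with u = a₁ - a₂s and v = b₁ - b₂s; positive real parts
give the beta integral and Γ(u + v) ≠ 0. -/
theorem foxXi_euler_step (hm : m ≤ lo.length) {s : ℂ} (ha : 0 < a₁ - a₂ * s.re)
    (hb : 0 < b₁ - b₂ * s.re) :
    foxXi m (n + 2) ((1 - a₁, a₂) :: (1 - b₁, b₂) :: up) (lo ++ [(1 - a₁ - b₁, a₂ + b₂)]) s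
      = foxXi m n up lo s * Complex.betaIntegral (a₁ - a₂ * s) (b₁ - b₂ * s) := by
  have h1 : 0 < ((a₁ : ℂ) - a₂ * s).re := by simpa using ha
  have h2 : 0 < ((b₁ : ℂ) - b₂ * s).re := by simpa using hb
  have h3 := Complex.Gamma_mul_Gamma_eq_betaIntegral h1 h2
  have h4 : Complex.Gamma (((a₁ : ℂ) - a₂ * s) + (b₁ - b₂ * s)) ≠ 0 :=
    Complex.Gamma_ne_zero_of_re_pos (by rw [Complex.add_re]; exact add_pos h1 h2)
  have h5 : Complex.betaIntegral (a₁ - a₂ * s) (b₁ - b₂ * s) =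
      Complex.Gamma (a₁ - a₂ * s) * Complex.Gamma (b₁ - b₂ * s) *
        (Complex.Gamma (((a₁ : ℂ) - a₂ * s) + (b₁ - b₂ * s)))⁻¹ := by
    rw [h3, mul_right_comm, mul_inv_cancel₀ h4, one_mul]
  have e1 : (1 : ℂ) - ((1 - a₁ : ℝ) : ℂ) - a₂ * s = a₁ - a₂ * s := by push_cast; ring
  have e2 : (1 : ℂ) - ((1 - b₁ : ℝ) : ℂ) - b₂ * s = b₁ - b₂ * s := by push_cast; ring
  have e3 : (1 : ℂ) - ((1 - a₁ - b₁ : ℝ) : ℂ) - ((a₂ + b₂ : ℝ) : ℂ) * s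
      = ((a₁ : ℂ) - a₂ * s) + (b₁ - b₂ * s) := by push_cast; ring
  simp only [foxXi, List.take_append_of_le_length hm, List.drop_append_of_le_length hm,
    List.take_succ_cons, List.drop_succ_cons, List.map_append, List.map_cons, List.prod_append,
    List.prod_cons, List.map_nil, List.prod_nil, mul_one, e1, e2, e3, h5, div_eq_mul_inv, mul_inv]
  ring

theorem IsFoxContour.euler_step {γ : ℝ → ℂ} (hγ : IsFoxContour m n up lo γ)
    (hm : m ≤ lo.length) (ha₂ : 0 < a₂) (hb₂ : 0 < b₂) (ha : ∀ t, (γ t).re < a₁ / a₂)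
    (hb : ∀ t, (γ t).re < b₁ / b₂) :
    IsFoxContour m (n + 2) ((1 - a₁, a₂) :: (1 - b₁, b₂) :: up)
      (lo ++ [(1 - a₁ - b₁, a₂ + b₂)]) γ := by
  refine ⟨hγ.1, fun y hy => ?_, fun x hx l => ?_⟩
  · rw [List.take_append_of_le_length hm] at hy
    exact hγ.2.1 y hy
  · simp only [List.take_succ_cons, List.mem_cons] at hx
    have hl : (0 : ℝ) ≤ l := Nat.cast_nonneg l
    rcases hx with rfl | rfl | hx
    · refine liesRightOf_of_re_lt hγ.1 (Complex.ofReal_im _) fun t => (ha t).trans_le ?_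
      rw [Complex.ofReal_re]
      exact div_le_div_of_nonneg_right (by simp only; linarith) ha₂.le
    · refine liesRightOf_of_re_lt hγ.1 (Complex.ofReal_im _) fun t => (hb t).trans_le ?_
      rw [Complex.ofReal_re]
      exact div_le_div_of_nonneg_right (by simp only; linarith) hb₂.le
    · exact hγ.2.2 x hx l

/-- The integrand of the Euler integral with the Mellin-Barnes integrand inserted. -/
noncomputable def eulerKernel (f : ℂ → ℂ) (γ : ℝ → ℂ) (a₁ a₂ b₁ b₂ z : ℝ) (p : ℝ × ℝ) : ℂ :=
  ((p.1 ^ (a₁ - 1) * (1 - p.1) ^ (b₁ - 1) : ℝ) : ℂ) *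
    (f (γ p.2) * ((z * p.1 ^ a₂ * (1 - p.1) ^ b₂ : ℝ) : ℂ) ^ (-γ p.2) * deriv γ p.2)

theorem euler_weight_mul_cpow {z x : ℝ} (hz : 0 < z) (hx : x ∈ Set.Ioo (0 : ℝ) 1) (s : ℂ) :
    ((x ^ (a₁ - 1) * (1 - x) ^ (b₁ - 1) : ℝ) : ℂ) * ((z * x ^ a₂ * (1 - x) ^ b₂ : ℝ) : ℂ) ^ (-s)
      = (z : ℂ) ^ (-s) * ((x : ℂ) ^ ((a₁ : ℂ) - a₂ * s - 1) *
        (1 - (x : ℂ)) ^ ((b₁ : ℂ) - b₂ * s - 1)) := by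
  have hx0 := hx.1
  have hx1 : 0 < 1 - x := sub_pos.2 hx.2
  have c0 : (x : ℂ) ≠ 0 := by exact_mod_cast hx0.ne'
  have c1 : (1 - (x : ℂ)) ≠ 0 := by exact_mod_cast hx1.ne'
  have key : ∀ (y e : ℝ), 0 < y → ((y ^ e : ℝ) : ℂ) ^ (-s) = (y : ℂ) ^ (-(e * s)) := by
    intro y e hy
    have hy' : (y : ℂ) ≠ 0 := by exact_mod_cast hy.ne'
    have he : ((y ^ e : ℝ) : ℂ) ≠ 0 := by exact_mod_cast (Real.rpow_pos_of_pos hy e).ne'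
    rw [Complex.cpow_def_of_ne_zero he, Complex.cpow_def_of_ne_zero hy', ← Complex.ofReal_log
      (Real.rpow_pos_of_pos hy e).le, Real.log_rpow hy, ← Complex.ofReal_log hy.le]
    push_cast
    ring_nf
  rw [Complex.ofReal_mul, Complex.ofReal_mul (z * x ^ a₂),
    Complex.mul_cpow_ofReal_nonneg (by positivity) (by positivity), Complex.ofReal_mul z,
    Complex.mul_cpow_ofReal_nonneg hz.le (by positivity), key _ _ hx0, key _ _ hx1,
    Complex.ofReal_cpow hx0.le, Complex.ofReal_cpow hx1.le]
  push_cast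
  rw [show (a₁ : ℂ) - a₂ * s - 1 = (a₁ - 1) + (-(a₂ * s)) by ring,
    show (b₁ : ℂ) - b₂ * s - 1 = (b₁ - 1) + (-(b₂ * s)) by ring, Complex.cpow_add _ _ c0,
    Complex.cpow_add _ _ c1]
  ring

theorem integrableOn_beta_weight {u v : ℝ} (hu : 0 < u) (hv : 0 < v) :
    IntegrableOn (fun x : ℝ => x ^ (u - 1) * (1 - x) ^ (v - 1)) (Set.Ioo 0 1) := by
  have h := (Complex.betaIntegral_convergent (u := u) (v := v) (by simpa) (by simpa)).norm
  rw [intervalIntegrable_iff_integrableOn_Ioo_of_le zero_le_one] at h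
  refine h.congr_fun (fun x hx => ?_) measurableSet_Ioo
  have hx1 : 0 < 1 - x := sub_pos.2 hx.2
  have e : (1 - (x : ℂ)) = ((1 - x : ℝ) : ℂ) := by push_cast; rfl
  simp only [norm_mul]
  rw [Complex.norm_cpow_eq_rpow_re_of_pos hx.1, e, Complex.norm_cpow_eq_rpow_re_of_pos hx1]
  simp

/-- The bound Re γ ≤ c₁ replaces the t-dependent exponents by fixed ones, so the majorant is a
product: a beta weight with parameters a₁ - a₂c₁, b₁ - b₂c₁ > 0 in x, and an exponential in t. -/
theorem integrable_eulerKernel {f : ℂ → ℂ} {γ : ℝ → ℂ} {c₁ C δ z : ℝ} (hz : 0 < z)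
    (hγ : IsBarnesPath γ) (ha₂ : 0 < a₂) (hb₂ : 0 < b₂) (hc : ∀ t, (γ t).re ≤ c₁)
    (ha : c₁ < a₁ / a₂) (hb : c₁ < b₁ / b₂) (hf : Continuous fun t => f (γ t)) (hδ : 0 < δ)
    (hbd : ∀ t, ‖f (γ t)‖ ≤ C * Real.exp (-δ * |t|)) :
    Integrable (eulerKernel f γ a₁ a₂ b₁ b₂ z)
      ((volume.restrict (Set.Ioo (0 : ℝ) 1)).prod volume) := by
  obtain ⟨K, c, R, hs⟩ := hγ.exists_stripPath
  obtain ⟨M, hM⟩ := hs.bound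
  rw [lt_div_iff₀ ha₂] at ha
  rw [lt_div_iff₀ hb₂] at hb
  have hmaj := (integrableOn_beta_weight (u := a₁ - a₂ * c₁) (v := b₁ - b₂ * c₁)
    (by linarith) (by linarith)).mul_prod
    ((integrable_exp_neg_mul_abs hδ).const_mul (C * (z ^ K + z ^ (-K)) * M))
  refine hmaj.mono' ?_ ?_
  · have hcont : Continuous γ := hs.cont
    have m1 : Measurable fun p : ℝ × ℝ => f (γ p.2) := hf.measurable.comp measurable_snd
    have m2 : Measurable fun p : ℝ × ℝ => γ p.2 := hcont.measurable.comp measurable_snd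
    have m3 : Measurable fun p : ℝ × ℝ => deriv γ p.2 := (measurable_deriv γ).comp measurable_snd
    refine Measurable.aestronglyMeasurable ?_
    exact (Complex.measurable_ofReal.comp (by fun_prop)).mul
      ((m1.mul ((Complex.measurable_ofReal.comp (by fun_prop)).pow m2.neg)).mul m3)
  · have hae : ∀ᵐ p ∂((volume.restrict (Set.Ioo (0 : ℝ) 1)).prod (volume : Measure ℝ)),
        p.1 ∈ Set.Ioo (0 : ℝ) 1 :=
      Measure.quasiMeasurePreserving_fst.ae (ae_restrict_mem measurableSet_Ioo)
    filter_upwards [hae] with p hp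
    have hp1 : 0 < 1 - p.1 := sub_pos.2 hp.2
    have e : eulerKernel f γ a₁ a₂ b₁ b₂ z p = f (γ p.2) * deriv γ p.2 *
        ((z : ℂ) ^ (-γ p.2) * ((p.1 : ℂ) ^ ((a₁ : ℂ) - a₂ * γ p.2 - 1) *
        (1 - (p.1 : ℂ)) ^ ((b₁ : ℂ) - b₂ * γ p.2 - 1))) := by
      rw [← euler_weight_mul_cpow hz hp, eulerKernel]
      ring
    have n1 : ‖(p.1 : ℂ) ^ ((a₁ : ℂ) - a₂ * γ p.2 - 1)‖ ≤ p.1 ^ (a₁ - a₂ * c₁ - 1) := by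
      rw [Complex.norm_cpow_eq_rpow_re_of_pos hp.1]
      refine Real.rpow_le_rpow_of_exponent_ge hp.1 hp.2.le ?_
      have := mul_le_mul_of_nonneg_left (hc p.2) ha₂.le
      simp only [Complex.sub_re, Complex.re_ofReal_mul, Complex.ofReal_re, Complex.one_re]
      linarith
    have n2 : ‖(1 - (p.1 : ℂ)) ^ ((b₁ : ℂ) - b₂ * γ p.2 - 1)‖ ≤ (1 - p.1) ^ (b₁ - b₂ * c₁ - 1) := by
      rw [← Complex.ofReal_one, ← Complex.ofReal_sub, Complex.norm_cpow_eq_rpow_re_of_pos hp1]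
      refine Real.rpow_le_rpow_of_exponent_ge hp1 (by linarith [hp.1]) ?_
      have := mul_le_mul_of_nonneg_left (hc p.2) hb₂.le
      simp only [Complex.sub_re, Complex.re_ofReal_mul, Complex.ofReal_re]
      linarith
    have n3 := norm_cpow_neg_le hz (hs.mem p.2).1 (hs.mem p.2).2
    have n4 := hbd p.2
    have n5 : 0 ≤ C * Real.exp (-δ * |p.2|) := (norm_nonneg _).trans n4
    have n6 : 0 ≤ z ^ K + z ^ (-K) := by positivity
    have n7 : 0 ≤ p.1 ^ (a₁ - a₂ * c₁ - 1) := Real.rpow_nonneg hp.1.le _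
    have n8 : 0 ≤ (1 - p.1) ^ (b₁ - b₂ * c₁ - 1) := Real.rpow_nonneg hp1.le _
    have n9 : 0 ≤ M := (norm_nonneg _).trans (hM 0)
    rw [e, norm_mul, norm_mul, norm_mul, norm_mul]
    calc _ ≤ C * Real.exp (-δ * |p.2|) * M * ((z ^ K + z ^ (-K)) *
          (p.1 ^ (a₁ - a₂ * c₁ - 1) * (1 - p.1) ^ (b₁ - b₂ * c₁ - 1))) := by
          gcongr
          exact hM _
      _ = _ := by ring

theorem PositiveOnPosReals.euler_step (h : FoxAdmissible m n up lo)
    (hpos : PositiveOnPosReals (foxH m n up lo)) (hχ : 0 < foxChi m n up lo) (ha₂ : 0 < a₂)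
    (hb₂ : 0 < b₂) (ha : 0 < a₁ + a₂ * foxMinRatio m lo)
    (hb : 0 < b₁ + b₂ * foxMinRatio m lo) :
    PositiveOnPosReals (foxH m (n + 2) ((1 - a₁, a₂) :: (1 - b₁, b₂) :: up)
      (lo ++ [(1 - a₁ - b₁, a₂ + b₂)])) := by
  have hup := h.up_pos
  have hlo := h.lo_pos
  have hadm := h.euler_step ha₂ hb₂ ha hb
  -- Positivity itself supplies a contour: without one, `foxH` is 0.
  have hex : ∃ γ : ℝ → ℂ, IsFoxContour m n up lo γ := by
    by_contra hcon
    have := (hpos 1 one_pos).1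
    rw [foxH, dif_neg hcon] at this
    simp at this
  obtain ⟨γ₀, hγ₀⟩ := hex
  have hσ : -foxMinRatio m lo < min (a₁ / a₂) (b₁ / b₂) := by
    rw [lt_min_iff, lt_div_iff₀ ha₂, lt_div_iff₀ hb₂]
    constructor <;> linarith
  obtain ⟨γ, hγ, c₁, hc₁, hγc⟩ := exists_isFoxContour_re_le hup hlo hγ₀ hσ
    fun w hw => re_le_of_mem_foxLeftPoles hlo hw
  obtain ⟨hca, hcb⟩ := lt_min_iff.1 hc₁
  have hγ' := hγ.euler_step h.m_le ha₂ hb₂ (fun t => (hγc t).trans_lt hca)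
    fun t => (hγc t).trans_lt hcb
  obtain ⟨K, c, R, hs⟩ := hγ.1.exists_stripPath
  obtain ⟨C, δ, hδ, hbd⟩ := exists_foxXi_path_bound hup hlo hχ hγ hs
  intro z hz
  rw [foxH_eq_barnesIntegral hadm.up_pos hadm.lo_pos (by rwa [foxChi_euler_step h.m_le]) hγ' hz]
  have hint := integrable_eulerKernel (f := foxXi m n up lo) hz hγ.1 ha₂ hb₂ hγc hca hcb
    (continuous_foxXi_path hup hlo hγ) hδ hbd
  set W : ℝ → ℝ := fun x => x ^ (a₁ - 1) * (1 - x) ^ (b₁ - 1) with hW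
  set Z : ℝ → ℝ := fun x => z * x ^ a₂ * (1 - x) ^ b₂ with hZ
  have hWpos : ∀ x ∈ Set.Ioo (0 : ℝ) 1, 0 < W x := fun x hx =>
    mul_pos (Real.rpow_pos_of_pos hx.1 _) (Real.rpow_pos_of_pos (sub_pos.2 hx.2) _)
  have hZpos : ∀ x ∈ Set.Ioo (0 : ℝ) 1, 0 < Z x := fun x hx =>
    mul_pos (mul_pos hz (Real.rpow_pos_of_pos hx.1 _)) (Real.rpow_pos_of_pos (sub_pos.2 hx.2) _)
  -- Integrating over the contour first gives the old function at Z x, along the same γ for every x.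
  have hin : ∀ x ∈ Set.Ioo (0 : ℝ) 1,
      (2 * (Real.pi : ℂ) * Complex.I)⁻¹ * ∫ t, eulerKernel (foxXi m n up lo) γ a₁ a₂ b₁ b₂ z (x, t)
        = ((W x * (foxH m n up lo (Z x)).re : ℝ) : ℂ) := by
    intro x hx
    have e1 : ((foxH m n up lo (Z x)).re : ℂ) = foxH m n up lo (Z x) :=
      Complex.ext (by simp) (by simpa using (hpos _ (hZpos x hx)).2.symm)
    rw [Complex.ofReal_mul, e1, foxH_eq_barnesIntegral hup hlo hχ hγ (hZpos x hx), barnesIntegral]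
    simp only [eulerKernel]
    rw [integral_const_mul]
    ring
  have hmain : barnesIntegral m (n + 2) ((1 - a₁, a₂) :: (1 - b₁, b₂) :: up)
      (lo ++ [(1 - a₁ - b₁, a₂ + b₂)]) γ z
      = ((∫ x in Set.Ioo (0 : ℝ) 1, W x * (foxH m n up lo (Z x)).re : ℝ) : ℂ) := by
    -- Integrating over x first gives the beta factor, hence the new integrand.
    have e1 : ∀ t, foxXi m (n + 2) ((1 - a₁, a₂) :: (1 - b₁, b₂) :: up)
        (lo ++ [(1 - a₁ - b₁, a₂ + b₂)]) (γ t) * (z : ℂ) ^ (-γ t) * deriv γ t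
        = ∫ x in Set.Ioo (0 : ℝ) 1, eulerKernel (foxXi m n up lo) γ a₁ a₂ b₁ b₂ z (x, t) := by
      intro t
      have hta := (hγc t).trans_lt hca
      have htb := (hγc t).trans_lt hcb
      rw [lt_div_iff₀ ha₂] at hta
      rw [lt_div_iff₀ hb₂] at htb
      rw [foxXi_euler_step h.m_le (by linarith) (by linarith), Complex.betaIntegral,
        intervalIntegral.integral_of_le zero_le_one, integral_Ioc_eq_integral_Ioo]
      rw [show ∀ A B I D : ℂ, A * I * B * D = (A * D) * (B * I) by intros; ring,
        ← integral_const_mul, ← integral_const_mul]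
      refine setIntegral_congr_fun measurableSet_Ioo fun x hx => ?_
      rw [← euler_weight_mul_cpow hz hx, eulerKernel]
      ring
    rw [barnesIntegral]
    simp only [e1]
    have e2 := integral_integral_swap (f := fun t x =>
      eulerKernel (foxXi m n up lo) γ a₁ a₂ b₁ b₂ z (x, t)) (μ := volume)
      (ν := volume.restrict (Set.Ioo (0 : ℝ) 1)) hint.swap
    rw [e2, ← integral_const_mul, setIntegral_congr_fun measurableSet_Ioo hin]
    exact integral_ofReal
  rw [hmain]
  refine ⟨?_, Complex.ofReal_im _⟩
  rw [Complex.ofReal_re]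
  have hintW : IntegrableOn (fun x => W x * (foxH m n up lo (Z x)).re) (Set.Ioo 0 1) := by
    have h1 := (hint.integral_prod_left.const_mul (2 * (Real.pi : ℂ) * Complex.I)⁻¹)
    have h2 : IntegrableOn (fun x => ((W x * (foxH m n up lo (Z x)).re : ℝ) : ℂ))
        (Set.Ioo 0 1) := IntegrableOn.congr_fun h1 hin measurableSet_Ioo
    exact h2.re
  have hp : ∀ x ∈ Set.Ioo (0 : ℝ) 1, 0 < W x * (foxH m n up lo (Z x)).re := fun x hx =>
    mul_pos (hWpos x hx) (hpos _ (hZpos x hx)).1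
  rw [setIntegral_pos_iff_support_of_nonneg_ae
    ((ae_restrict_mem measurableSet_Ioo).mono fun x hx => (hp x hx).le) hintW]
  refine lt_of_lt_of_le ?_ (measure_mono (s := Set.Ioo (0 : ℝ) 1) fun x hx => ⟨(hp x hx).ne', hx⟩)
  simp

end beta

/-! ### Iteration of the step -/

/-- The indices k - j descend, so the newest pairs come first, while the lower list grows at its
end. This is the shape produced by one Euler step. -/
theorem eulerUpper_succ (k : ℕ) (om lam : ℕ → ℝ) :
    eulerUpper (k + 1) om lam = (1 - om (2 * k + 1), om (2 * (k + 1))) ::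
      (1 - lam (2 * k + 1), lam (2 * (k + 1))) :: eulerUpper k om lam := by
  have e : List.range' (1 + 1) k = (List.range' 1 k).map (· + 1) := List.range'_succ_left
  rw [eulerUpper, List.range'_succ, List.flatMap_cons, e, List.flatMap_map]
  simp only [Nat.add_sub_add_right, Nat.add_sub_cancel]
  rfl

theorem eulerLower_succ (k : ℕ) (om lam : ℕ → ℝ) :
    eulerLower (k + 1) om lam = eulerLower k om lam ++
      [(1 - om (2 * k + 1) - lam (2 * k + 1), om (2 * (k + 1)) + lam (2 * (k + 1)))] := by
  rw [eulerLower, List.range'_1_concat, List.map_append, List.map_cons, List.map_nil,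
    Nat.add_comm 1 k, show 2 * (k + 1) - 1 = 2 * k + 1 by omega]
  rfl

/-- Added lower pairs stand beyond position m, so the hypotheses on the minimum persist through the
iteration. -/
theorem foxMinRatio_append {m : ℕ} {lo : List (ℝ × ℝ)} (hm : m ≤ lo.length) (l : List (ℝ × ℝ)) :
    foxMinRatio m (lo ++ l) = foxMinRatio m lo := by
  rw [foxMinRatio, foxMinRatio, List.take_append_of_le_length hm]

theorem corollary3 (m n k : ℕ) (up lo : List (ℝ × ℝ)) (om lam : ℕ → ℝ)
    (hadm : FoxAdmissible m n up lo)
    (hpos : PositiveOnPosReals (foxH m n up lo))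
    (hmn : 0 < m * n) (hchi : 0 < foxChi m n up lo) (hk : 1 ≤ k)
    (hom : ∀ j ∈ Finset.Icc 1 k, 0 < om (2 * j))
    (hlam : ∀ j ∈ Finset.Icc 1 k, 0 < lam (2 * j))
    (hmin₁ : ∀ j ∈ Finset.Icc 1 k, 0 < om (2 * j - 1) + om (2 * j) * foxMinRatio m lo)
    (hmin₂ : ∀ j ∈ Finset.Icc 1 k, 0 < lam (2 * j - 1) + lam (2 * j) * foxMinRatio m lo) :
    FoxAdmissible m (n + 2 * k) (eulerUpper k om lam ++ up) (lo ++ eulerLower k om lam) ∧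
    PositiveOnPosReals
      (foxH m (n + 2 * k) (eulerUpper k om lam ++ up) (lo ++ eulerLower k om lam)) := by
  -- χ > 0 is carried along because each step needs the decay of the current integrand.
  suffices h : ∀ i ≤ k,
      FoxAdmissible m (n + 2 * i) (eulerUpper i om lam ++ up) (lo ++ eulerLower i om lam) ∧
      0 < foxChi m (n + 2 * i) (eulerUpper i om lam ++ up) (lo ++ eulerLower i om lam) ∧
      PositiveOnPosReals
        (foxH m (n + 2 * i) (eulerUpper i om lam ++ up) (lo ++ eulerLower i om lam)) from
    ⟨(h k le_rfl).1, (h k le_rfl).2.2⟩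
  intro i
  induction i with
  | zero =>
    intro _
    simpa [eulerUpper, eulerLower] using ⟨hadm, hchi, hpos⟩
  | succ i ih =>
    intro hi
    obtain ⟨h1, h2, h3⟩ := ih (by omega)
    have hmem : i + 1 ∈ Finset.Icc 1 k := Finset.mem_Icc.2 ⟨by omega, hi⟩
    have e : 2 * (i + 1) - 1 = 2 * i + 1 := by omega
    have ho := hom _ hmem
    have hl := hlam _ hmem
    have ho' := hmin₁ _ hmem
    have hl' := hmin₂ _ hmem
    rw [e, ← foxMinRatio_append hadm.m_le (eulerLower i om lam)] at ho' hl'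
    rw [eulerUpper_succ, eulerLower_succ, List.cons_append, List.cons_append,
      ← List.append_assoc, show n + 2 * (i + 1) = n + 2 * i + 2 by omega]
    exact ⟨h1.euler_step ho hl ho' hl', by rwa [foxChi_euler_step h1.m_le],
      h3.euler_step h1 h2 ho hl ho' hl'⟩
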